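/- **Theorem.** For every $R>0$ and every $\delta>0$ there is a nonzero axisymmetric field $u\in C_0^\infty(\mathbb R^3;\mathbb R^3)$ and a function $p\in C^\infty(\mathbb R^3)$ with $(u\cdot\nabla)u=-\nabla p$ and $\operatorname{div}u=0$ on $\mathbb R^3$, such that $\operatorname{supp}u$ lies in the solid torus $T_{R,\delta}=\{(\rho-R)^2+z^2<\delta^2\}$ around the circle $C_R=\{\rho=R,\ z=0\}$. Here $(\rho,\varphi,z)$ are cylindrical coordinates, with unit vectors $e_\rho,e_\varphi,e_z$. Moreover, such flows arise as follows. There are $r>0$ and an analytic function $\psi$ on $(-r,r)$ with $\psi'\neq0$ that solves $$3x\psi''+6x(\psi')^3-4\psi(\psi')^2-3\psi'=0,\qquad \psi(0)=1,\quad \psi'(0)=-\tfrac34 .$$ Put $$F(x,\alpha)=-2x\psi(\alpha)+2x^3,\quad H(\alpha)=6\alpha\Big(\frac1{\psi'(\alpha)}+2\psi(\alpha)\Big),\quad G(x,\alpha)=12x^2\alpha-F(x,\alpha)^2-H(\alpha).$$ There are an open neighbourhood $U\subset\{x>0\}$ of $(1,0)$ in $\mathbb R^2$ and an analytic function $\alpha:U\to(-r,r)$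 with $$\partial_x\alpha=F(x,\alpha),\qquad(\partial_y\alpha)^2=G(x,\alpha)\quad\text{on }U,\qquad \alpha(1,0)=0,\qquad \partial_y\alpha\not\equiv0,$$ which has a strict minimum over $U$ at $(1,0)$. These $\psi,\alpha,U$ have the following properties for every $R>0$. Let $D_R=\{(\rho/R,z/R)\in U\}\subset\mathbb R^3$ and on $D_R$ put $$a=\alpha\Big(\frac\rho R,\frac zR\Big),\quad p=\frac{R^4a}4,\quad b=\frac{R^3}4\sqrt{H(a)},\quad u=\frac1\rho\Big(\frac{\partial p}{\partial z}e_\rho-\frac{\partial p}{\partial\rho}e_z+b\,e_\varphi\Big).$$ 1. On $D_R\setminus C_R$ the pair $(u,p)$ is a smooth axisymmetric steady incompressible Euler flow, and it satisfies $u\cdot\nabla p=0$ and $|u|^2=3p$. 2. For every $\delta>0$ there is $\varepsilon_0>0$ such that for all $0<\varepsilon<\varepsilon_0$ and all $\omega\in C^\infty(\mathbb R)$ with $\operatorname{supp}\omega\subset[\varepsilon,2\varepsilon]$, the field $\widetilde u$ equal to $\omega(p)u$ on $D_R$ and to $0$ outside $D_R$ is axisymmetric, belongs to $C_0^\infty(\mathbb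 R^3;\mathbb R^3)$, has support in $T_{R,\delta}\cap D_R$, and is a steady incompressible Euler flow on $\mathbb R^3$ with a smooth pressure $\widetilde p$ such that $\nabla\widetilde p=\omega(p)^2\nabla p$ on $D_R$. If $\omega\not\equiv0$, then $\widetilde u\not\equiv0$. -/

import Mathlib

open Set Filter Topology
open scoped ContDiff

noncomputable section

namespace SteadyEuler

/-- Euclidean three-space. -/
abbrev E3 : Type := EuclideanSpace ℝ (Fin 3)

/-- The divergence `∑ i, ∂ᵢ uᵢ` of a vector field. -/
def divergence (u : E3 → E3) (x : E3) : ℝ :=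
  ∑ i : Fin 3, fderiv ℝ u x (EuclideanSpace.single i 1) i

/-- The convective term `(u · ∇) u`: the derivative of `u` at `x` in the direction `u x`. -/
def convective (u : E3 → E3) (x : E3) : E3 := fderiv ℝ u x (u x)

/-- `(u, p)` is a smooth steady incompressible Euler flow on the set `S` (used for open `S`). -/
structure IsSteadyEulerOn (u : E3 → E3) (p : E3 → ℝ) (S : Set E3) : Prop where
  smooth_velocity : ContDiffOn ℝ ∞ u S
  smooth_pressure : ContDiffOn ℝ ∞ p S
  momentum : ∀ x ∈ S, convective u x = -gradient p x
  incompressible : ∀ x ∈ S, divergence u x = 0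

/-- The rotation by the angle `θ` about the third coordinate axis. -/
def rotZ (θ : ℝ) (x : E3) : E3 :=
  !₂[Real.cos θ * x 0 - Real.sin θ * x 1, Real.sin θ * x 0 + Real.cos θ * x 1, x 2]

/-- Axial symmetry of a vector field (swirl is allowed). -/
def IsAxisymmetric (u : E3 → E3) : Prop := ∀ (θ : ℝ) (x : E3), u (rotZ θ x) = rotZ θ (u x)

/-! Cylindrical coordinates; the height is `x 2`. -/

/-- The distance to the axis. -/
def rho (x : E3) : ℝ := Real.sqrt (x 0 ^ 2 + x 1 ^ 2)

/-- The radial unit vector (off the axis). -/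
def eRho (x : E3) : E3 := !₂[x 0 / rho x, x 1 / rho x, 0]

/-- The azimuthal unit vector (off the axis). -/
def ePhi (x : E3) : E3 := !₂[-x 1 / rho x, x 0 / rho x, 0]

/-- The axial unit vector. -/
def eZ : E3 := !₂[0, 0, 1]

/-- The circle `ρ = R`, `z = 0`. -/
def circleR (R : ℝ) : Set E3 := {x | rho x = R ∧ x 2 = 0}

/-- The open solid torus of tube radius `δ` around the circle `ρ = R`, `z = 0`
(the points at distance less than `δ` from the circle). -/
def solidTorus (R δ : ℝ) : Set E3 := {x | (rho x - R) ^ 2 + x 2 ^ 2 < δ ^ 2}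

/-! The functions `F`, `G`, `H` determined by `ψ`. -/

def F (ψ : ℝ → ℝ) (x a : ℝ) : ℝ := -2 * x * ψ a + 2 * x ^ 3

def H (ψ : ℝ → ℝ) (a : ℝ) : ℝ := 6 * a * (1 / deriv ψ a + 2 * ψ a)

def G (ψ : ℝ → ℝ) (x a : ℝ) : ℝ := 12 * x ^ 2 * a - F ψ x a ^ 2 - H ψ a

/-- `ψ` is an analytic solution on `(-r, r)` of the singular Cauchy problem
`3 x ψ'' + 6 x ψ'³ - 4 ψ ψ'² - 3 ψ' = 0`, `ψ 0 = 1`, `ψ' 0 = -3/4`, and `ψ'` does not vanish. -/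
structure IsPsi (ψ : ℝ → ℝ) (r : ℝ) : Prop where
  pos : 0 < r
  analytic : AnalyticOnNhd ℝ ψ (Ioo (-r) r)
  ode : ∀ x ∈ Ioo (-r) r, 3 * x * deriv (deriv ψ) x + 6 * x * deriv ψ x ^ 3
    - 4 * ψ x * deriv ψ x ^ 2 - 3 * deriv ψ x = 0
  value : ψ 0 = 1
  slope : deriv ψ 0 = -3 / 4
  slope_ne : ∀ x ∈ Ioo (-r) r, deriv ψ x ≠ 0

/-- `α` is an analytic solution of `∂ₓ α = F(x, α)`, `(∂_y α)² = G(x, α)` on the open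
neighbourhood `U` of `(1, 0)` with `α (1, 0) = 0` and `∂_y α ≢ 0`,
and it has a strict minimum at `(1, 0)`. -/
structure IsAlpha (ψ : ℝ → ℝ) (r : ℝ) (α : ℝ × ℝ → ℝ) (U : Set (ℝ × ℝ)) : Prop where
  isOpen : IsOpen U
  mem : ((1 : ℝ), (0 : ℝ)) ∈ U
  off_axis : ∀ q ∈ U, 0 < q.1
  analytic : AnalyticOnNhd ℝ α U
  range : ∀ q ∈ U, α q ∈ Ioo (-r) r
  eq_x : ∀ q ∈ U, deriv (fun t => α (t, q.2)) q.1 = F ψ q.1 (α q)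
  eq_y : ∀ q ∈ U, deriv (fun t => α (q.1, t)) q.2 ^ 2 = G ψ q.1 (α q)
  nondegenerate : ∃ q ∈ U, deriv (fun t => α (q.1, t)) q.2 ≠ 0
  value : α (1, 0) = 0
  strict_min : ∀ q ∈ U, q ≠ (1, 0) → α (1, 0) < α q

/-- The region of space where `(ρ / R, z / R)` lies in `U`. -/
def region (U : Set (ℝ × ℝ)) (R : ℝ) : Set E3 := {x | (rho x / R, x 2 / R) ∈ U}

/-- The pressure `R⁴ a / 4`, `a = α(ρ / R, z / R)`, as a function of `(ρ, z)`. -/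
def pressureProfile (α : ℝ × ℝ → ℝ) (R ρ z : ℝ) : ℝ := R ^ 4 / 4 * α (ρ / R, z / R)

/-- The pressure of the intermediate flow. -/
def pressure (α : ℝ × ℝ → ℝ) (R : ℝ) (x : E3) : ℝ := pressureProfile α R (rho x) (x 2)

/-- The function `b = (R³ / 4) √(H(a))`, `a = α(ρ / R, z / R)`. -/
def swirl (ψ : ℝ → ℝ) (α : ℝ × ℝ → ℝ) (R : ℝ) (x : E3) : ℝ :=
  R ^ 3 / 4 * Real.sqrt (H ψ (α (rho x / R, x 2 / R)))

/-- The velocity `u = (1 / ρ) (∂_z p e_ρ - ∂_ρ p e_z + b e_φ)` of the intermediate flow. -/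
def velocity (ψ : ℝ → ℝ) (α : ℝ × ℝ → ℝ) (R : ℝ) (x : E3) : E3 :=
  (1 / rho x) •
    (deriv (fun z => pressureProfile α R (rho x) z) (x 2) • eRho x
      - deriv (fun ρ => pressureProfile α R ρ (x 2)) (rho x) • eZ
      + swirl ψ α R x • ePhi x)

open Classical in
/-- The modulated field: `w(p) u` in the region over `U`, and zero elsewhere. -/
def modulated (ψ : ℝ → ℝ) (α : ℝ × ℝ → ℝ) (U : Set (ℝ × ℝ)) (R : ℝ) (w : ℝ → ℝ) (x : E3) : E3 :=
  if x ∈ region U R then w (pressure α R x) • velocity ψ α R x else 0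

end SteadyEuler

end

open SteadyEuler

/-! If a steady flow satisfies `u · ∇p = 0`, then `w(p) u` is again divergence free for every smooth
`w`, and its convective term is `w(p)² (u · ∇)u = -w(p)² ∇p`, minus the gradient of a function of
`p`. So it suffices to find such a flow around the circle whose pressure has a strict minimum on the
circle. A cutoff `w` supported in `[ε, 2ε]` confines it to a thin toroidal shell that avoids the
circle, where the flow itself need not be smooth.

To obtain `u · ∇p = 0`, the pressure itself serves as stream function and the angular momentum `b`
is a function of `p`. Adding the condition `|u|² = 3p` leads to the overdetermined system `∂ₓα = F`,
`(∂_yα)² = G`. It is consistent when `∂ₓG + F ∂ₐG = 2 G ∂ₐF`. With the given `H` this is an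
algebraic identity (`IsPsi.compatibility`) once `H' = 4ψ + 24aψ'`, and that relation is the equation
for `ψ` (`IsPsi.hasDerivAt_H`).

Since `G` vanishes at `(1, 0)`, the first order equation in `y` is degenerate there. Its
differentiated form `g'' = ∂ₐG(1, g)/2` is regular and gives `α` on the line `x = 1`, from which
`∂ₓα = F` extends it. The defect `(∂_yα)² - G` is zero at `(1, 0)`, constant along the line and
solves a linear homogeneous equation in `x`, so it vanishes (`IsPsi.exists_isProfile`). Both pure
second derivatives of `α` at `(1, 0)` equal `4`, which gives the strict minimum.

All analytic solutions, including that of the singular problem for `ψ`, come from the analytic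
implicit function theorem in `C([0, 1])` applied to the rescaled unknown `s ↦ v(ts)`. Equivariance
under dilations shows that the solutions for different `t` are pieces of one function
(`exists_analyticAt_dilation_family`). -/

namespace SteadyEuler

/-! ### Analytic fixed points in `C([0, 1])` that commute with dilations. -/

section

open scoped unitInterval

/-- Precomposition of a continuous function on the unit interval with `s ↦ l * s`. -/
def dilate (l : I) (u : C(I, ℝ)) : C(I, ℝ) := u.comp ⟨fun s => l * s, by fun_prop⟩

@[simp] lemma dilate_apply (l : I) (u : C(I, ℝ)) (s : I) : dilate l u s = u (l * s) := rfl

lemma dist_dilate_const_le (l : I) (u : C(I, ℝ)) (c : ℝ) :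
    dist (dilate l u) (ContinuousMap.const I c) ≤ dist u (ContinuousMap.const I c) := by
  rw [ContinuousMap.dist_le dist_nonneg]
  intro s
  exact ContinuousMap.dist_apply_le_dist (f := u) (g := ContinuousMap.const I c) (l * s)

/-- A fixed point problem that commutes with dilations has, near a base point where the partial
derivative vanishes, an analytic family of solutions, all of which come from one function. -/
theorem exists_analyticAt_dilation_family {P : Type*} [NormedAddCommGroup P] [NormedSpace ℝ P]
    [CompleteSpace P] (Q : (ℝ × P) × C(I, ℝ) → C(I, ℝ)) (p₀ : P) (c : ℝ)
    (hQ : AnalyticAt ℝ Q ((0, p₀), ContinuousMap.const I c))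
    (h0 : Q ((0, p₀), ContinuousMap.const I c) = ContinuousMap.const I c)
    (hd : HasFDerivAt (fun u => Q ((0, p₀), u)) (0 : C(I, ℝ) →L[ℝ] C(I, ℝ))
      (ContinuousMap.const I c))
    (hD : ∀ᶠ z in 𝓝 ((((0 : ℝ), p₀), ContinuousMap.const I c) : (ℝ × P) × C(I, ℝ)),
      ∀ l : I, Q ((l * z.1.1, z.1.2), dilate l z.2) = dilate l (Q z)) :
    ∃ φ : ℝ × P → C(I, ℝ), AnalyticAt ℝ φ (0, p₀) ∧ φ (0, p₀) = ContinuousMap.const I c ∧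
      ∀ᶠ z in 𝓝 ((0 : ℝ), p₀), Q (z, φ z) = φ z ∧ ∀ s : I, φ z s = φ (s * z.1, z.2) 1 := by
  set z₀ : (ℝ × P) × C(I, ℝ) := ((0, p₀), ContinuousMap.const I c) with hz₀
  let f : (ℝ × P) × C(I, ℝ) → C(I, ℝ) := fun z => z.2 - Q z
  have hf : AnalyticAt ℝ f z₀ := analyticAt_snd.sub hQ
  have cdf : ContDiffAt ℝ ω f z₀ := hf.contDiffAt
  -- As `Q` has zero partial derivative in `u`, that of `u - Q` is the identity and the implicit
  -- function theorem applies.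
  have hpart : fderiv ℝ f z₀ ∘L .inr ℝ (ℝ × P) C(I, ℝ) = ContinuousLinearMap.id ℝ _ := by
    have h1 : HasFDerivAt (fun u : C(I, ℝ) => f ((0, p₀), u))
        (fderiv ℝ f z₀ ∘L .inr ℝ (ℝ × P) C(I, ℝ)) (ContinuousMap.const I c) :=
      HasFDerivAt.comp (ContinuousMap.const I c) hf.differentiableAt.hasFDerivAt
        (hasFDerivAt_prodMk_right ((0 : ℝ), p₀) (ContinuousMap.const I c))
    have h2 : HasFDerivAt (fun u : C(I, ℝ) => f ((0, p₀), u))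
        (ContinuousLinearMap.id ℝ _ - 0) (ContinuousMap.const I c) :=
      (hasFDerivAt_id _).sub hd
    rw [h1.unique h2, sub_zero]
  have if₂ : (fderiv ℝ f z₀ ∘L .inr ℝ (ℝ × P) C(I, ℝ)).IsInvertible := by
    rw [hpart]; exact ContinuousLinearMap.isInvertible_equiv (f := ContinuousLinearEquiv.refl ℝ _)
  have hn : (ω : WithTop ℕ∞) ≠ 0 := by simp
  have hφ := cdf.contDiffAt_implicitFunction hn if₂
  have hφ0 := cdf.implicitFunction_apply_self hn if₂
  have hφe := cdf.eventually_apply_eq_iff_implicitFunction hn if₂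
  set φ := cdf.implicitFunction hn if₂
  have hfz : f z₀ = 0 := sub_eq_zero.2 h0.symm
  refine ⟨φ, hφ.analyticAt, hφ0, ?_⟩
  obtain ⟨ε, hε, hball⟩ := Metric.eventually_nhds_iff.1 (hφe.and hD)
  have hcont : ContinuousAt (fun z => (z, φ z)) ((0 : ℝ), p₀) :=
    continuousAt_id.prodMk hφ.continuousAt
  have hnear : ∀ᶠ z in 𝓝 ((0 : ℝ), p₀), dist (z, φ z) z₀ < ε := by
    have h3 := hcont.eventually (Metric.ball_mem_nhds _ hε)
    filter_upwards [h3] with z hz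
    rw [show φ (0, p₀) = ContinuousMap.const I c from hφ0] at hz
    exact hz
  filter_upwards [hnear] with z hz
  have hfix : Q (z, φ z) = φ z := by
    have := (hball hz).1.2 rfl
    rw [hfz] at this
    exact (sub_eq_zero.1 this).symm
  refine ⟨hfix, fun s => ?_⟩
  -- Dilation shrinks the time and does not increase the distance to a constant, so the dilated pair
  -- stays in the ball of local uniqueness and must be the solution at time `s * z.1`.
  have hz' : dist (((s * z.1, z.2), dilate s (φ z)) : (ℝ × P) × C(I, ℝ)) z₀ < ε := by
    refine lt_of_le_of_lt ?_ hz
    simp only [hz₀, Prod.dist_eq, Real.dist_eq, sub_zero]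
    refine max_le_max (max_le_max ?_ le_rfl) (dist_dilate_const_le _ _ _)
    rw [abs_mul, abs_of_nonneg s.2.1]
    exact mul_le_of_le_one_left (abs_nonneg _) s.2.2
  have heq : f ((s * z.1, z.2), dilate s (φ z)) = f z₀ := by
    rw [hfz]
    have := (hball hz).2 s
    simp only [hfix] at this
    simp [f, this]
  have := (hball hz').1.1 heq
  rw [show φ (s * z.1, z.2) = dilate s (φ z) from this]
  simp

/-- The averages `s ↦ ∫₀¹ u (s τ) dτ`. -/
noncomputable def average : C(I, ℝ) →L[ℝ] C(I, ℝ) :=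
  LinearMap.mkContinuous
    { toFun := fun u => ⟨fun s => ∫ τ in (0 : ℝ)..1, u (s * projIcc 0 1 zero_le_one τ), by
        apply intervalIntegral.continuous_parametric_intervalIntegral_of_continuous'
        have : Continuous (projIcc (0 : ℝ) 1 zero_le_one) := continuous_projIcc
        fun_prop⟩
      map_add' := fun u v => by
        have : Continuous (projIcc (0 : ℝ) 1 zero_le_one) := continuous_projIcc
        ext s
        simp only [ContinuousMap.coe_mk, ContinuousMap.add_apply]
        apply intervalIntegral.integral_add <;> apply Continuous.intervalIntegrable <;> fun_prop
      map_smul' := fun a v => by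
        ext s
        simp }
    1 (fun u => by
      rw [one_mul, ContinuousMap.norm_le _ (norm_nonneg _)]
      intro s
      refine (intervalIntegral.norm_integral_le_of_norm_le_const (C := ‖u‖) ?_).trans (by simp)
      intro τ _
      exact u.norm_coe_le_norm _)

lemma average_apply (u : C(I, ℝ)) (s : I) :
    average u s = ∫ τ in (0 : ℝ)..1, u (s * projIcc 0 1 zero_le_one τ) := rfl

lemma average_dilate (l : I) (u : C(I, ℝ)) : average (dilate l u) = dilate l (average u) := by
  ext s
  simp [average_apply, mul_assoc]

lemma average_const (c : ℝ) : average (ContinuousMap.const I c) = ContinuousMap.const I c := by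
  ext s
  simp [average_apply]

/-- If `u s = f (x s)`, the average at `s` is the mean of `f` over `[0, x s]`. -/
lemma mul_average_apply {u : C(I, ℝ)} {f : ℝ → ℝ} {x : ℝ} (h : ∀ s : I, u s = f (s * x)) (s : I) :
    (s * x) * average u s = ∫ t in (0 : ℝ)..(s * x), f t := by
  rw [average_apply]
  have : ∫ τ in (0 : ℝ)..1, u (s * projIcc 0 1 zero_le_one τ)
      = ∫ τ in (0 : ℝ)..1, f ((s * x) * τ) := by
    apply intervalIntegral.integral_congr
    intro τ hτ
    rw [uIcc_of_le zero_le_one] at hτ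
    simp only [h, projIcc_of_mem _ hτ]
    congr 1
    push_cast
    ring
  rw [this]
  simp

/-- The inclusion of the unit interval in the reals. -/
def coord : C(I, ℝ) := ⟨fun s => s, by fun_prop⟩

@[simp] lemma coord_apply (s : I) : coord s = (s : ℝ) := rfl

/-- Composition with an analytic function is analytic on continuous functions. -/
theorem exists_analyticAt_comp {f : ℝ → ℝ} (hf : AnalyticAt ℝ f 0) :
    ∃ Ψ : C(I, ℝ) → C(I, ℝ), AnalyticAt ℝ Ψ 0 ∧ ∀ᶠ u in 𝓝 (0 : C(I, ℝ)),
      (∀ s, Ψ u s = f (u s)) ∧ ∀ l, Ψ (dilate l u) = dilate l (Ψ u) := by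
  obtain ⟨p, r, hp⟩ := hf
  let q : FormalMultilinearSeries ℝ C(I, ℝ) C(I, ℝ) :=
    FormalMultilinearSeries.ofScalars C(I, ℝ) (fun n => p.coeff n)
  -- The series with the same scalar coefficients in the Banach algebra `C(I, ℝ)` has terms of the
  -- same norm, hence converges at least as far.
  have hrad : r ≤ q.radius := by
    refine hp.r_le.trans ?_
    apply FormalMultilinearSeries.radius_le_of_le
    intro n
    rw [FormalMultilinearSeries.ofScalars_norm, ← FormalMultilinearSeries.norm_apply_eq_norm_coef]
  have hq : HasFPowerSeriesOnBall q.sum q 0 r :=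
    (q.hasFPowerSeriesOnBall (hp.r_pos.trans_le hrad)).mono hp.r_pos hrad
  have key : ∀ u ∈ Metric.eball (0 : C(I, ℝ)) r, ∀ s, q.sum u s = f (u s) := by
    intro u hu s
    have h1 := hq.hasSum hu
    rw [zero_add] at h1
    have h2 : HasSum (fun n => (q n fun _ => u) s) (q.sum u s) :=
      h1.map (ContinuousMap.evalCLM ℝ s) (ContinuousMap.evalCLM ℝ s).continuous
    have h3 : u s ∈ Metric.eball (0 : ℝ) r := by
      rw [Metric.mem_eball, edist_zero_right] at hu ⊢
      exact lt_of_le_of_lt (enorm_le_iff_norm_le.2 (u.norm_coe_le_norm s)) hu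
    have h4 := hp.hasSum h3
    rw [zero_add] at h4
    have h5 : (fun n => (q n fun _ => u) s) = fun n => p n fun _ => u s := by
      funext n
      simp [q, FormalMultilinearSeries.ofScalars_apply_eq, mul_comm]
    rw [h5] at h2
    exact h2.unique h4
  refine ⟨q.sum, hq.analyticAt, ?_⟩
  filter_upwards [Metric.eball_mem_nhds (0 : C(I, ℝ)) hp.r_pos] with u hu
  refine ⟨key u hu, fun l => ?_⟩
  have hl : dilate l u ∈ Metric.eball (0 : C(I, ℝ)) r := by
    rw [Metric.mem_eball] at hu ⊢
    refine lt_of_le_of_lt ?_ hu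
    rw [edist_dist, edist_dist]
    exact ENNReal.ofReal_le_ofReal (dist_dilate_const_le l u 0)
  ext s
  rw [key _ hl, dilate_apply, dilate_apply, key u hu]

/-- The fundamental theorem of calculus for a function continuous on a symmetric interval. -/
lemma hasDerivAt_integral_of_continuousOn {f : ℝ → ℝ} {r x : ℝ} (hf : ContinuousOn f (Ioo (-r) r))
    (hx : x ∈ Ioo (-r) r) : HasDerivAt (fun y => ∫ t in (0 : ℝ)..y, f t) (f x) x := by
  have hr : 0 < r := by linarith [hx.1, hx.2]
  refine intervalIntegral.integral_hasDerivAt_right ?_ ?_ (hf.continuousAt (isOpen_Ioo.mem_nhds hx))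
  · apply ContinuousOn.intervalIntegrable
    exact hf.mono (ordConnected_Ioo.uIcc_subset ⟨by linarith, hr⟩ hx)
  · exact hf.stronglyMeasurableAtFilter isOpen_Ioo x hx

lemma exists_Ioo_of_eventually {p : ℝ → Prop} (h : ∀ᶠ x in 𝓝 (0 : ℝ), p x) :
    ∃ r > 0, ∀ x ∈ Ioo (-r) r, p x := by
  obtain ⟨r, hr, h⟩ := Metric.eventually_nhds_iff.1 h
  refine ⟨r, hr, fun x hx => h ?_⟩
  rw [Real.dist_eq, sub_zero, abs_lt]
  exact hx

/-! ### The singular Cauchy problem for `ψ`. -/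

/-- The singular Cauchy problem for `ψ'`, divided by `3` and written as a fixed point problem for
`s ↦ ψ' (t s)`. The second component of the parameter is not used. -/
noncomputable def slopeMap (z : (ℝ × ℝ) × C(I, ℝ)) : C(I, ℝ) :=
  average ((2 : ℝ) • z.2 + (4 / 3 : ℝ) • ((1 + z.1.1 • (coord * average z.2)) * (z.2 * z.2))
    - (2 * z.1.1) • (coord * (z.2 * z.2 * z.2)))

lemma analyticAt_slopeMap (z : (ℝ × ℝ) × C(I, ℝ)) : AnalyticAt ℝ slopeMap z := by
  have h1 : AnalyticAt ℝ (fun z : (ℝ × ℝ) × C(I, ℝ) => z.1.1) z :=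
    analyticAt_fst.comp analyticAt_fst
  have h2 : AnalyticAt ℝ (fun z : (ℝ × ℝ) × C(I, ℝ) => z.2) z := analyticAt_snd
  have h3 : AnalyticAt ℝ (fun z : (ℝ × ℝ) × C(I, ℝ) => average z.2) z :=
    (average.analyticAt _).comp h2
  refine (average.analyticAt _).comp (f := fun z : (ℝ × ℝ) × C(I, ℝ) =>
    ((2 : ℝ) • z.2 + (4 / 3 : ℝ) • ((1 + z.1.1 • (coord * average z.2)) * (z.2 * z.2))
    - (2 * z.1.1) • (coord * (z.2 * z.2 * z.2)))) ?_
  exact ((analyticAt_const.fun_smul h2).fun_add (analyticAt_const.fun_smul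
    ((analyticAt_const.fun_add (h1.fun_smul (analyticAt_const.fun_mul h3))).fun_mul
      (h2.fun_mul h2)))).fun_sub
    ((analyticAt_const.fun_mul h1).fun_smul (analyticAt_const.fun_mul ((h2.fun_mul h2).fun_mul h2)))

lemma slopeMap_dilate (l : I) (z : (ℝ × ℝ) × C(I, ℝ)) :
    slopeMap ((l * z.1.1, z.1.2), dilate l z.2) = dilate l (slopeMap z) := by
  unfold slopeMap
  rw [← average_dilate, average_dilate]
  congr 1
  ext s
  simp
  ring

lemma slopeMap_base : slopeMap ((0, 0), ContinuousMap.const I (-3 / 4))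
    = ContinuousMap.const I (-3 / 4) := by
  unfold slopeMap
  rw [← average_const (-3 / 4)]
  congr 1
  ext s
  simp [average_const]
  norm_num

/-- At `t = 0` the integrand is `2u + (4/3)u²`, whose derivative `2 + (8/3)u` vanishes exactly at `u
= -3/4`. This makes the singular problem nondegenerate at the prescribed slope. -/
lemma hasFDerivAt_slopeMap : HasFDerivAt (fun u => slopeMap ((0, 0), u))
    (0 : C(I, ℝ) →L[ℝ] C(I, ℝ)) (ContinuousMap.const I (-3 / 4)) := by
  have h1 := hasFDerivAt_id (𝕜 := ℝ) (ContinuousMap.const I (-3 / 4 : ℝ))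
  have h2 := average.hasFDerivAt.comp _ ((h1.const_smul (2 : ℝ)).add
    ((h1.mul h1).const_smul (4 / 3 : ℝ)))
  convert! h2 using 1
  · ext u s
    simp [slopeMap]
  · ext1 h
    simp only [_root_.zero_apply, ContinuousLinearMap.comp_apply]
    rw [← map_zero average]
    congr 1
    ext s
    simp
    ring

/-- With `U = ψ'` the equation becomes `(xU)' = 2U + (4/3)ψU² - 2xU³`, so `U` is an average of the
right-hand side over `[0, x]`, and the singularity at `0` disappears. The extra positivity makes `H`
positive for positive argument, so that `√H` is smooth there. -/
theorem exists_isPsi : ∃ (ψ : ℝ → ℝ) (r : ℝ), IsPsi ψ r ∧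
    ∀ a ∈ Ioo (-r) r, 0 < 1 / deriv ψ a + 2 * ψ a := by
  obtain ⟨φ, hφ, hφ0, hev⟩ := exists_analyticAt_dilation_family slopeMap 0 (-3 / 4)
    (analyticAt_slopeMap _) slopeMap_base hasFDerivAt_slopeMap
    (Eventually.of_forall fun z l => slopeMap_dilate l z)
  let v : ℝ → C(I, ℝ) := fun x => φ (x, 0)
  have hv : AnalyticAt ℝ v 0 :=
    AnalyticAt.comp (f := fun x : ℝ => (x, (0 : ℝ))) hφ (analyticAt_id.prod analyticAt_const)
  have hι : Tendsto (fun x : ℝ => (x, (0 : ℝ))) (𝓝 0) (𝓝 (0, 0)) :=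
    (Continuous.prodMk continuous_id continuous_const).tendsto 0
  let U : ℝ → ℝ := fun x => v x 1
  let ψ : ℝ → ℝ := fun x => 1 + x * average (v x) 1
  have hU : AnalyticAt ℝ U 0 := ((ContinuousMap.evalCLM ℝ (1 : I) : C(I, ℝ) →L[ℝ] ℝ).analyticAt _).comp hv
  have hψ : AnalyticAt ℝ ψ 0 := analyticAt_const.add (analyticAt_id.mul
    (((ContinuousMap.evalCLM ℝ (1 : I) : C(I, ℝ) →L[ℝ] ℝ).analyticAt _).comp ((average.analyticAt _).comp hv)))
  have hU0 : U 0 = -3 / 4 := by simp [U, v, hφ0]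
  have hψ0 : ψ 0 = 1 := by simp [ψ]
  have hpos : ∀ᶠ x in 𝓝 (0 : ℝ), U x < 0 ∧ 0 < 1 / U x + 2 * ψ x := by
    have h1 : ContinuousAt (fun x => 1 / U x + 2 * ψ x) 0 := by
      have := hU.continuousAt
      have := hψ.continuousAt
      have : U 0 ≠ 0 := by rw [hU0]; norm_num
      fun_prop (disch := assumption)
    refine (hU.continuousAt.eventually_lt_const (by rw [hU0]; norm_num)).and
      (h1.eventually_const_lt ?_)
    -- The value at `0` is `-4/3 + 2 = 2/3`.
    simp only [hU0, hψ0]; norm_num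
  obtain ⟨r, hr, H⟩ := exists_Ioo_of_eventually ((hι.eventually hev).and
    (hU.eventually_analyticAt.and (hψ.eventually_analyticAt.and hpos)))
  have hUa : ∀ x ∈ Ioo (-r) r, AnalyticAt ℝ U x := fun x hx => (H x hx).2.1
  have hUc : ContinuousOn U (Ioo (-r) r) := fun x hx => (hUa x hx).continuousAt.continuousWithinAt
  have hψa : ∀ x ∈ Ioo (-r) r, AnalyticAt ℝ ψ x := fun x hx => (H x hx).2.2.1
  have hψc : ContinuousOn ψ (Ioo (-r) r) := fun x hx => (hψa x hx).continuousAt.continuousWithinAt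
  have hsc : ∀ x ∈ Ioo (-r) r, ∀ s : I, (s : ℝ) * x ∈ Ioo (-r) r := fun x hx s => by
    have := s.2.1; have := s.2.2
    constructor <;> nlinarith [hx.1, hx.2]
  have hvU : ∀ x ∈ Ioo (-r) r, ∀ s : I, v x s = U (s * x) := fun x hx s => (H x hx).1.2 s
  have hψI : ∀ x ∈ Ioo (-r) r, ψ x = 1 + ∫ t in (0 : ℝ)..x, U t := fun x hx => by
    have := mul_average_apply (hvU x hx) 1
    simp only [Icc.coe_one, one_mul] at this
    rw [← this]
  have hdψ : ∀ x ∈ Ioo (-r) r, HasDerivAt ψ (U x) x := fun x hx => by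
    refine ((hasDerivAt_integral_of_continuousOn hUc hx).const_add 1).congr_of_eventuallyEq ?_
    filter_upwards [isOpen_Ioo.mem_nhds hx] with y hy using hψI y hy
  have hdψ' : ∀ x ∈ Ioo (-r) r, deriv ψ x = U x := fun x hx => (hdψ x hx).deriv
  let W : ℝ → ℝ := fun x => 2 * U x + 4 / 3 * (ψ x * (U x * U x)) - 2 * x * (U x * U x * U x)
  have hWc : ContinuousOn W (Ioo (-r) r) := by fun_prop
  have hxU : ∀ x ∈ Ioo (-r) r, x * U x = ∫ t in (0 : ℝ)..x, W t := fun x hx => by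
    set w : C(I, ℝ) := ((2 : ℝ) • v x + (4 / 3 : ℝ) • ((1 + x • (coord * average (v x))) *
      (v x * v x)) - (2 * x) • (coord * (v x * v x * v x)))
    have hw : ∀ s : I, w s = W (s * x) := fun s => by
      have h1 := mul_average_apply (hvU x hx) s
      have h2 := hψI _ (hsc x hx s)
      have h3 := hvU x hx s
      simp only [w, W, ContinuousMap.add_apply, ContinuousMap.sub_apply, ContinuousMap.smul_apply,
        ContinuousMap.mul_apply, ContinuousMap.one_apply, smul_eq_mul, coord_apply]
      rw [h2, ← h1, h3]
      ring
    have h1 := mul_average_apply hw 1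
    simp only [Icc.coe_one, one_mul] at h1
    rw [← h1]
    have h2 : average w = v x := (H x hx).1.1
    rw [h2]
  refine ⟨ψ, r, ⟨hr, hψa, fun x hx => ?_, hψ0, ?_, fun x hx => ?_⟩, fun x hx => ?_⟩
  · have h1 : deriv (deriv ψ) x = deriv U x := by
      apply Filter.EventuallyEq.deriv_eq
      filter_upwards [isOpen_Ioo.mem_nhds hx] with y hy using hdψ' y hy
    have h2 : HasDerivAt (fun x => x * U x) (1 * U x + x * deriv U x) x :=
      (hasDerivAt_id x).mul (hUa x hx).differentiableAt.hasDerivAt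
    have h3 : HasDerivAt (fun x => x * U x) (W x) x := by
      refine (hasDerivAt_integral_of_continuousOn hWc hx).congr_of_eventuallyEq ?_
      filter_upwards [isOpen_Ioo.mem_nhds hx] with y hy using hxU y hy
    have h4 := h2.unique h3
    rw [h1, hdψ' x hx]
    simp only [W] at h4
    linear_combination 3 * h4
  · rw [hdψ' 0 ⟨by linarith, hr⟩, hU0]
  · rw [hdψ' x hx]; exact (H x hx).2.2.2.1.ne
  · rw [hdψ' x hx]; exact (H x hx).2.2.2.2

/-! ### Two regular Cauchy problems with analytic solutions. -/

/-- The solutions of `∂ₜ v = 1 + t - f v` depend analytically on time and initial value. -/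
theorem exists_analyticAt_flow {f : ℝ → ℝ} (hf : AnalyticAt ℝ f 0) :
    ∃ V : ℝ × ℝ → ℝ, AnalyticAt ℝ V (0, 0) ∧ V (0, 0) = 0 ∧ ∀ᶠ z in 𝓝 ((0 : ℝ), (0 : ℝ)),
      V (0, z.2) = z.2 ∧ HasDerivAt (fun t => V (t, z.2)) (1 + z.1 - f (V z)) z.1 := by
  obtain ⟨Ψ, hΨ, hΨe⟩ := exists_analyticAt_comp hf
  let Q : (ℝ × ℝ) × C(I, ℝ) → C(I, ℝ) := fun z =>
    z.1.2 • 1 + z.1.1 • (coord * average (1 + z.1.1 • coord - Ψ z.2))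
  have hQ : AnalyticAt ℝ Q ((0, 0), ContinuousMap.const I 0) := by
    have h1 : AnalyticAt ℝ (fun z : (ℝ × ℝ) × C(I, ℝ) => z.1.1)
      ((0, 0), ContinuousMap.const I 0) := analyticAt_fst.comp analyticAt_fst
    have h2 : AnalyticAt ℝ (fun z : (ℝ × ℝ) × C(I, ℝ) => z.1.2)
      ((0, 0), ContinuousMap.const I 0) := analyticAt_snd.comp analyticAt_fst
    have h3 : AnalyticAt ℝ (fun z : (ℝ × ℝ) × C(I, ℝ) => Ψ z.2)
      ((0, 0), ContinuousMap.const I 0) := AnalyticAt.comp (g := Ψ) hΨ analyticAt_snd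
    exact (h2.fun_smul analyticAt_const).fun_add (h1.fun_smul (analyticAt_const.fun_mul
      ((average.analyticAt _).comp
        ((analyticAt_const.fun_add (h1.fun_smul analyticAt_const)).fun_sub h3))))
  -- At time `0` the integral terms drop out and `Q` does not depend on `u`, so its partial
  -- derivative is zero.
  have hcst : ∀ u, Q ((0, 0), u) = ContinuousMap.const I 0 := fun u => by
    simp only [Q, zero_smul, add_zero]; rfl
  have hD : ∀ᶠ z in 𝓝 (((0, 0), ContinuousMap.const I 0) : (ℝ × ℝ) × C(I, ℝ)),
      ∀ l : I, Q ((l * z.1.1, z.1.2), dilate l z.2) = dilate l (Q z) := by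
    filter_upwards [(continuous_snd.tendsto
      (((0, 0), ContinuousMap.const I 0) : (ℝ × ℝ) × C(I, ℝ))).eventually hΨe] with z hz l
    have h1 : average (1 + (l * z.1.1 : ℝ) • coord - Ψ (dilate l z.2))
        = dilate l (average (1 + z.1.1 • coord - Ψ z.2)) := by
      rw [← average_dilate, hz.2 l]
      congr 1
      ext s
      simp
      ring
    ext s
    simp only [Q, h1]
    simp
    ring
  obtain ⟨φ, hφ, hφ0, hev⟩ := exists_analyticAt_dilation_family Q 0 0 hQ (hcst _)
    (by simp only [hcst]; exact hasFDerivAt_const _ _) hD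
  let V : ℝ × ℝ → ℝ := fun z => φ z 1
  have hV : AnalyticAt ℝ V (0, 0) :=
    ((ContinuousMap.evalCLM ℝ (1 : I) : C(I, ℝ) →L[ℝ] ℝ).analyticAt _).comp hφ
  have hV0 : V (0, 0) = 0 := by simp [V, hφ0]
  refine ⟨V, hV, hV0, ?_⟩
  have hfa : ∀ᶠ z in 𝓝 ((0 : ℝ), (0 : ℝ)), AnalyticAt ℝ f (V z) := by
    have h := hV.continuousAt.tendsto
    rw [hV0] at h
    exact h.eventually hf.eventually_analyticAt
  have hφΨ : ∀ᶠ z in 𝓝 ((0 : ℝ), (0 : ℝ)), ∀ s, Ψ (φ z) s = f (φ z s) := by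
    have h := hφ.continuousAt.tendsto
    rw [hφ0] at h
    exact h.eventually (hΨe.mono fun u hu => hu.1)
  obtain ⟨r, hr, H⟩ := Metric.eventually_nhds_iff.1
    (hev.and (hV.eventually_analyticAt.and (hfa.and hφΨ)))
  refine Metric.eventually_nhds_iff.2 ⟨r, hr, fun z hz => ?_⟩
  obtain ⟨x, a⟩ := z
  simp only [Prod.dist_eq, Real.dist_eq, sub_zero, max_lt_iff] at hz
  have hbox : ∀ t ∈ Ioo (-r) r, dist (t, a) ((0 : ℝ), (0 : ℝ)) < r := fun t ht => by
    simp only [Prod.dist_eq, Real.dist_eq, sub_zero]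
    exact max_lt (abs_lt.2 ht) hz.2
  have hx : x ∈ Ioo (-r) r := abs_lt.1 hz.1
  let W : ℝ → ℝ := fun t => 1 + t - f (V (t, a))
  have hW : ContinuousOn W (Ioo (-r) r) := by
    intro t ht
    have h1 : ContinuousAt V (t, a) := (H (hbox t ht)).2.1.continuousAt
    have h2 : ContinuousAt f (V (t, a)) := (H (hbox t ht)).2.2.1.continuousAt
    have h3 : ContinuousAt (fun t => V (t, a)) t :=
      ContinuousAt.comp (f := fun t => (t, a)) h1 (by fun_prop)
    have h4 : ContinuousAt (fun t => f (V (t, a))) t :=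
      ContinuousAt.comp (f := fun t => V (t, a)) h2 h3
    exact ((continuousAt_const.add continuousAt_id).sub h4).continuousWithinAt
  have hint : ∀ t ∈ Ioo (-r) r, V (t, a) = a + ∫ τ in (0 : ℝ)..t, W τ := fun t ht => by
    obtain ⟨⟨hfix, hdil⟩, -, -, hcomp⟩ := H (hbox t ht)
    have hw : ∀ s : I, (1 + t • coord - Ψ (φ (t, a))) s = W (s * t) := fun s => by
      simp only [ContinuousMap.add_apply, ContinuousMap.sub_apply, ContinuousMap.smul_apply,
        ContinuousMap.one_apply, smul_eq_mul, coord_apply, W, V, hcomp, hdil s]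
      ring
    have h1 := mul_average_apply hw 1
    simp only [Icc.coe_one, one_mul] at h1
    rw [← h1]
    have h2 : V (t, a) = Q ((t, a), φ (t, a)) 1 := by rw [hfix]
    rw [h2]
    simp [Q]
  refine ⟨?_, ?_⟩
  · simpa using hint 0 ⟨by linarith, hr⟩
  · refine ((hasDerivAt_integral_of_continuousOn hW hx).const_add a).congr_of_eventuallyEq ?_
    filter_upwards [isOpen_Ioo.mem_nhds hx] with t ht using hint t ht

/-- The Cauchy problem `g'' = f g`, `g 0 = 0`, `g' 0 = 0` has an analytic solution. -/
theorem exists_analyticAt_second_order {f : ℝ → ℝ} (hf : AnalyticAt ℝ f 0) :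
    ∃ g : ℝ → ℝ, AnalyticAt ℝ g 0 ∧ g 0 = 0 ∧ deriv g 0 = 0 ∧
      ∀ᶠ y in 𝓝 (0 : ℝ), HasDerivAt (deriv g) (f (g y)) y := by
  obtain ⟨Ψ, hΨ, hΨe⟩ := exists_analyticAt_comp hf
  -- Each factor `t • (coord * average _)` is an integration from `0` to `ts`; two of them invert
  -- the second derivative with zero data. The second parameter is idle.
  let Q : (ℝ × ℝ) × C(I, ℝ) → C(I, ℝ) := fun z =>
    z.1.1 • (coord * average (z.1.1 • (coord * average (Ψ z.2))))
  have hQ : AnalyticAt ℝ Q ((0, 0), ContinuousMap.const I 0) := by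
    have h1 : AnalyticAt ℝ (fun z : (ℝ × ℝ) × C(I, ℝ) => z.1.1)
      ((0, 0), ContinuousMap.const I 0) := analyticAt_fst.comp analyticAt_fst
    have h3 : AnalyticAt ℝ (fun z : (ℝ × ℝ) × C(I, ℝ) => Ψ z.2)
      ((0, 0), ContinuousMap.const I 0) := AnalyticAt.comp (g := Ψ) hΨ analyticAt_snd
    exact h1.fun_smul (analyticAt_const.fun_mul ((average.analyticAt _).comp
      (h1.fun_smul (analyticAt_const.fun_mul ((average.analyticAt _).comp h3)))))
  have hcst : ∀ u, Q ((0, 0), u) = ContinuousMap.const I 0 := fun u => by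
    simp only [Q, zero_smul]; rfl
  have hD : ∀ᶠ z in 𝓝 (((0, 0), ContinuousMap.const I 0) : (ℝ × ℝ) × C(I, ℝ)),
      ∀ l : I, Q ((l * z.1.1, z.1.2), dilate l z.2) = dilate l (Q z) := by
    filter_upwards [(continuous_snd.tendsto
      (((0, 0), ContinuousMap.const I 0) : (ℝ × ℝ) × C(I, ℝ))).eventually hΨe] with z hz l
    have h1 : average ((l * z.1.1 : ℝ) • (coord * average (Ψ (dilate l z.2))))
        = dilate l (average (z.1.1 • (coord * average (Ψ z.2)))) := by
      rw [← average_dilate, hz.2 l, average_dilate]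
      congr 1
      ext s
      simp
      ring
    ext s
    simp only [Q, h1]
    simp
    ring
  obtain ⟨φ, hφ, hφ0, hev⟩ := exists_analyticAt_dilation_family Q 0 0 hQ (hcst _)
    (by simp only [hcst]; exact hasFDerivAt_const _ _) hD
  let v : ℝ → C(I, ℝ) := fun x => φ (x, 0)
  have hv : AnalyticAt ℝ v 0 :=
    AnalyticAt.comp (f := fun x : ℝ => (x, (0 : ℝ))) hφ (analyticAt_id.prod analyticAt_const)
  have hι : Tendsto (fun x : ℝ => (x, (0 : ℝ))) (𝓝 0) (𝓝 (0, 0)) :=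
    (Continuous.prodMk continuous_id continuous_const).tendsto 0
  let g : ℝ → ℝ := fun x => v x 1
  have hg : AnalyticAt ℝ g 0 :=
    ((ContinuousMap.evalCLM ℝ (1 : I) : C(I, ℝ) →L[ℝ] ℝ).analyticAt _).comp hv
  have hg0 : g 0 = 0 := by simp [g, v, hφ0]
  have hfa : ∀ᶠ x in 𝓝 (0 : ℝ), AnalyticAt ℝ f (g x) := by
    have h := hg.continuousAt.tendsto
    rw [hg0] at h
    exact h.eventually hf.eventually_analyticAt
  have hvΨ : ∀ᶠ x in 𝓝 (0 : ℝ), ∀ s, Ψ (v x) s = f (v x s) := by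
    have h := hv.continuousAt.tendsto
    rw [show v 0 = ContinuousMap.const I 0 from hφ0] at h
    exact h.eventually (hΨe.mono fun u hu => hu.1)
  obtain ⟨r, hr, H⟩ := exists_Ioo_of_eventually
    ((hι.eventually hev).and (hg.eventually_analyticAt.and (hfa.and hvΨ)))
  let W : ℝ → ℝ := fun t => f (g t)
  have hW : ContinuousOn W (Ioo (-r) r) := fun t ht =>
    (ContinuousAt.comp (f := g) (H t ht).2.2.1.continuousAt
      (H t ht).2.1.continuousAt).continuousWithinAt
  let Z : ℝ → ℝ := fun x => ∫ t in (0 : ℝ)..x, W t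
  have hZ : ∀ x ∈ Ioo (-r) r, HasDerivAt Z (W x) x := fun x hx =>
    hasDerivAt_integral_of_continuousOn hW hx
  have hZc : ContinuousOn Z (Ioo (-r) r) := fun x hx => (hZ x hx).continuousAt.continuousWithinAt
  have hint : ∀ x ∈ Ioo (-r) r, g x = ∫ t in (0 : ℝ)..x, Z t := fun x hx => by
    obtain ⟨⟨hfix, hdil⟩, -, -, hcomp⟩ := H x hx
    have hw : ∀ s : I, Ψ (v x) s = W (s * x) := fun s => by
      simp only [hcomp, W, g, v, hdil s]
    have hw2 : ∀ s : I, (x • (coord * average (Ψ (v x)))) s = Z (s * x) := fun s => by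
      rw [show Z (s * x) = _ from (mul_average_apply hw s).symm]
      simp
      ring
    have h1 := mul_average_apply hw2 1
    simp only [Icc.coe_one, one_mul] at h1
    rw [← h1]
    have h2 : g x = Q ((x, 0), φ (x, 0)) 1 := by rw [hfix]
    rw [h2]
    simp [Q, v]
  have hdg : ∀ x ∈ Ioo (-r) r, deriv g x = Z x := fun x hx => by
    refine HasDerivAt.deriv
      ((hasDerivAt_integral_of_continuousOn hZc hx).congr_of_eventuallyEq ?_)
    filter_upwards [isOpen_Ioo.mem_nhds hx] with t ht using hint t ht
  have h0 : (0 : ℝ) ∈ Ioo (-r) r := ⟨by linarith, hr⟩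
  refine ⟨g, hg, hg0, by rw [hdg 0 h0]; simp [Z], ?_⟩
  filter_upwards [isOpen_Ioo.mem_nhds h0] with x hx
  refine (hZ x hx).congr_of_eventuallyEq ?_
  filter_upwards [isOpen_Ioo.mem_nhds hx] with t ht using hdg t ht

end

/-! ### Derivatives and compatibility of `F`, `G`, `H`. -/

/-- The derivative of `F ψ x` in its last argument. -/
noncomputable def dF (ψ : ℝ → ℝ) (x a : ℝ) : ℝ := -2 * x * deriv ψ a

/-- The derivative of `G ψ x` in its last argument, for `ψ` a solution of the Cauchy problem. -/
noncomputable def dG (ψ : ℝ → ℝ) (x a : ℝ) : ℝ :=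
  12 * x ^ 2 - 2 * F ψ x a * dF ψ x a - (4 * ψ a + 24 * a * deriv ψ a)

section

variable {ψ : ℝ → ℝ} {r a : ℝ}

lemma IsPsi.zero_mem (h : IsPsi ψ r) : (0 : ℝ) ∈ Ioo (-r) r := ⟨by linarith [h.pos], h.pos⟩

lemma IsPsi.hasDerivAt (h : IsPsi ψ r) (ha : a ∈ Ioo (-r) r) : HasDerivAt ψ (deriv ψ a) a :=
  (h.analytic a ha).differentiableAt.hasDerivAt

/-- The quotient rule produces `ψ''`; after clearing `ψ'²` the claimed formula is the differential
equation of `ψ`, up to a factor. This is the only role of that equation. -/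
lemma IsPsi.hasDerivAt_H (h : IsPsi ψ r) (ha : a ∈ Ioo (-r) r) :
    HasDerivAt (H ψ) (4 * ψ a + 24 * a * deriv ψ a) a := by
  have h0 := h.slope_ne a ha
  have h1 := h.hasDerivAt ha
  have h2 : HasDerivAt (deriv ψ) (deriv (deriv ψ) a) a :=
    (h.analytic a ha).deriv.differentiableAt.hasDerivAt
  have h3 := ((hasDerivAt_id a).const_mul 6).mul
    (((hasDerivAt_const a (1 : ℝ)).div h2 h0).add (h1.const_mul 2))
  convert! h3 using 1
  have hode := h.ode a ha
  simp only [id, Pi.add_apply, Pi.div_apply]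
  field_simp
  linear_combination (2 : ℝ) * hode

lemma IsPsi.analyticAt_H (h : IsPsi ψ r) (ha : a ∈ Ioo (-r) r) : AnalyticAt ℝ (H ψ) a := by
  have h1 := h.analytic a ha
  exact (analyticAt_const.fun_mul analyticAt_id).fun_mul
    ((analyticAt_const.fun_div h1.deriv (h.slope_ne a ha)).fun_add (analyticAt_const.fun_mul h1))

lemma IsPsi.hasDerivAt_F (h : IsPsi ψ r) {x b : ℝ → ℝ} {x' b' t : ℝ} (hb : b t ∈ Ioo (-r) r)
    (dx : HasDerivAt x x' t) (db : HasDerivAt b b' t) :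
    HasDerivAt (fun t => F ψ (x t) (b t))
      ((-2 * ψ (b t) + 6 * x t ^ 2) * x' + dF ψ (x t) (b t) * b') t := by
  have h1 := (h.hasDerivAt hb).comp t db
  convert! ((dx.const_mul (-2)).mul h1).add ((dx.pow 3).const_mul 2) using 1
  simp [dF]
  ring

lemma IsPsi.hasDerivAt_G (h : IsPsi ψ r) {x b : ℝ → ℝ} {x' b' t : ℝ} (hb : b t ∈ Ioo (-r) r)
    (dx : HasDerivAt x x' t) (db : HasDerivAt b b' t) :
    HasDerivAt (fun t => G ψ (x t) (b t))
      ((24 * x t * b t - 2 * F ψ (x t) (b t) * (-2 * ψ (b t) + 6 * x t ^ 2)) * x'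
        + dG ψ (x t) (b t) * b') t := by
  have h1 := (h.hasDerivAt_H hb).comp t db
  convert! ((((dx.pow 2).const_mul 12).mul db).sub ((h.hasDerivAt_F hb dx db).pow 2)).sub h1 using 1
  simp [dG]
  ring

/-- The compatibility of `∂ₓ α = F` with `(∂_y α)² = G`. -/
lemma IsPsi.compatibility (h : IsPsi ψ r) (ha : a ∈ Ioo (-r) r) (x : ℝ) :
    24 * x * a - 2 * F ψ x a * (-2 * ψ a + 6 * x ^ 2) + dG ψ x a * F ψ x a
      = 2 * dF ψ x a * G ψ x a := by
  have h0 := h.slope_ne a ha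
  simp only [dG, G, H, dF, F]
  field_simp
  ring

end

/-! ### Tools on coordinate lines: linear equations, convexity, mixed derivatives. -/

/-- A solution of a homogeneous linear equation that vanishes once vanishes identically. -/
lemma eq_zero_of_linear_ode {e c : ℝ → ℝ} {x₀ η K : ℝ} (hη : 0 < η)
    (hc : ∀ x ∈ Ioo (x₀ - η) (x₀ + η), |c x| ≤ K)
    (he : ∀ x ∈ Ioo (x₀ - η) (x₀ + η), HasDerivAt e (c x * e x) x) (h0 : e x₀ = 0) :
    ∀ x ∈ Ioo (x₀ - η) (x₀ + η), e x = 0 := by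
  have hx₀ : x₀ ∈ Ioo (x₀ - η) (x₀ + η) := ⟨by linarith, by linarith⟩
  have hK : 0 ≤ K := (abs_nonneg _).trans (hc x₀ hx₀)
  have := ODE_solution_unique_of_mem_Ioo (v := fun x y => c x * y) (s := fun _ => univ)
    (K := ⟨K, hK⟩) (f := e) (g := fun _ => 0) (a := x₀ - η) (b := x₀ + η) (t₀ := x₀)
    (fun x hx => (LipschitzWith.of_dist_le_mul fun y z => by
      rw [Real.dist_eq, Real.dist_eq, ← mul_sub, abs_mul]
      exact mul_le_mul_of_nonneg_right (hc x hx) (abs_nonneg _)).lipschitzOnWith) hx₀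
    (fun x hx => ⟨he x hx, mem_univ _⟩)
    (fun x hx => ⟨by simpa using hasDerivAt_const x (0 : ℝ), mem_univ _⟩) h0
  exact fun x hx => this hx

/-- Quadratic growth of a function with second derivative at least `2` away from a critical point. -/
lemma sq_add_le_of_two_le_deriv {f f' f'' : ℝ → ℝ} {x₀ η : ℝ} (hη : 0 < η)
    (hf : ∀ x ∈ Ioo (x₀ - η) (x₀ + η), HasDerivAt f (f' x) x)
    (hf' : ∀ x ∈ Ioo (x₀ - η) (x₀ + η), HasDerivAt f' (f'' x) x)
    (h2 : ∀ x ∈ Ioo (x₀ - η) (x₀ + η), 2 ≤ f'' x) (h0 : f' x₀ = 0) :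
    ∀ x ∈ Ioo (x₀ - η) (x₀ + η), f x₀ + (x - x₀) ^ 2 ≤ f x := by
  have hx₀ : x₀ ∈ Ioo (x₀ - η) (x₀ + η) := ⟨by linarith, by linarith⟩
  let k : ℝ → ℝ := fun x => f x - (x - x₀) ^ 2
  have hk : ∀ x ∈ Ioo (x₀ - η) (x₀ + η), HasDerivAt k (f' x - 2 * (x - x₀)) x := fun x hx => by
    convert! (hf x hx).sub (((hasDerivAt_id x).sub_const x₀).pow 2) using 1
    simp
  have hmono : MonotoneOn (fun x => f' x - 2 * (x - x₀)) (Ioo (x₀ - η) (x₀ + η)) := by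
    have hd : ∀ x ∈ Ioo (x₀ - η) (x₀ + η),
        HasDerivAt (fun x => f' x - 2 * (x - x₀)) (f'' x - 2) x := fun x hx => by
      convert! (hf' x hx).sub (((hasDerivAt_id x).sub_const x₀).const_mul 2) using 1
      simp
    refine monotoneOn_of_deriv_nonneg (convex_Ioo _ _)
      (fun x hx => (hd x hx).continuousAt.continuousWithinAt) ?_ ?_ <;>
      rw [interior_Ioo] <;> intro x hx
    · exact (hd x hx).differentiableAt.differentiableWithinAt
    · rw [(hd x hx).deriv]; linarith [h2 x hx]
  have hconv : ConvexOn ℝ (Ioo (x₀ - η) (x₀ + η)) k := by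
    refine MonotoneOn.convexOn_of_deriv (convex_Ioo _ _)
      (fun x hx => (hk x hx).continuousAt.continuousWithinAt) ?_ ?_ <;> rw [interior_Ioo]
    · exact fun x hx => (hk x hx).differentiableAt.differentiableWithinAt
    · intro x hx y hy hxy
      rw [(hk x hx).deriv, (hk y hy).deriv]
      exact hmono hx hy hxy
  intro x hx
  have hd := hk x₀ hx₀
  rw [h0] at hd
  have hmin : IsMinOn k (Ioo (x₀ - η) (x₀ + η)) x₀ := by
    refine hconv.isMinOn_of_rightDeriv_eq_zero ?_ ?_
    · rwa [interior_Ioo]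
    · exact hd.hasDerivWithinAt.derivWithin (uniqueDiffWithinAt_Ioi _) |>.trans (by simp)
  have := hmin hx
  simp only [k, mem_ofPred_eq] at this
  linarith

/-- Equality of the mixed second derivatives of an analytic function of two variables. -/
lemma exists_hasDerivAt_mixed {α : ℝ × ℝ → ℝ} {x y : ℝ} (h : AnalyticAt ℝ α (x, y)) :
    ∃ m : ℝ, HasDerivAt (fun t => fderiv ℝ α (t, y) (0, 1)) m x ∧
      HasDerivAt (fun t => fderiv ℝ α (x, t) (1, 0)) m y := by
  have h1 : HasFDerivAt (fderiv ℝ α) (fderiv ℝ (fderiv ℝ α) (x, y)) (x, y) :=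
    h.fderiv.differentiableAt.hasFDerivAt
  have hsym : IsSymmSndFDerivAt ℝ α (x, y) :=
    (h.contDiffAt (n := 2)).isSymmSndFDerivAt (by simp)
  refine ⟨fderiv ℝ (fderiv ℝ α) (x, y) (1, 0) (0, 1), ?_, ?_⟩
  · have h2 : HasDerivAt (fun t : ℝ => (t, y)) (1, 0) x :=
      (hasDerivAt_id x).prodMk (hasDerivAt_const x y)
    have h3 := (h1.comp_hasDerivAt (f := fun t => (t, y)) x h2).clm_apply
      (hasDerivAt_const x ((0 : ℝ), (1 : ℝ)))
    simpa using h3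
  · have h2 : HasDerivAt (fun t : ℝ => (x, t)) (0, 1) y :=
      (hasDerivAt_const y x).prodMk (hasDerivAt_id y)
    have h3 := (h1.comp_hasDerivAt (f := fun t => (x, t)) y h2).clm_apply
      (hasDerivAt_const y ((1 : ℝ), (0 : ℝ)))
    rw [hsym (1, 0) (0, 1)]
    simpa using h3

lemma hasDerivAt_snd_of_analyticAt {α : ℝ × ℝ → ℝ} {x y : ℝ} (h : AnalyticAt ℝ α (x, y)) :
    HasDerivAt (fun t => α (x, t)) (fderiv ℝ α (x, y) (0, 1)) y :=
  h.differentiableAt.hasFDerivAt.comp_hasDerivAt (f := fun t => (x, t)) y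
    ((hasDerivAt_const y x).prodMk (hasDerivAt_id y))

lemma hasDerivAt_fst_of_analyticAt {α : ℝ × ℝ → ℝ} {x y : ℝ} (h : AnalyticAt ℝ α (x, y)) :
    HasDerivAt (fun t => α (t, y)) (fderiv ℝ α (x, y) (1, 0)) x :=
  h.differentiableAt.hasFDerivAt.comp_hasDerivAt (f := fun t => (t, y)) x
    ((hasDerivAt_id x).prodMk (hasDerivAt_const x y))

/-! ### The profile `α` near `(1, 0)`. -/

/-- `α` solves `∂ₓ α = F`, `(∂_y α)² = G` on the ball of radius `η` around `(1, 0)`, with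
`β = ∂_y α`, and it grows quadratically away from `(1, 0)`. -/
structure IsProfile (ψ : ℝ → ℝ) (r : ℝ) (α β : ℝ × ℝ → ℝ) (η : ℝ) : Prop where
  pos : 0 < η
  lt_one : η < 1
  value : α (1, 0) = 0
  range : ∀ q ∈ Metric.ball ((1 : ℝ), (0 : ℝ)) η, α q ∈ Ioo (-r) r
  analytic : AnalyticOnNhd ℝ α (Metric.ball (1, 0) η)
  analytic' : AnalyticOnNhd ℝ β (Metric.ball (1, 0) η)
  fst : ∀ q ∈ Metric.ball ((1 : ℝ), (0 : ℝ)) η,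
    HasDerivAt (fun t => α (t, q.2)) (F ψ q.1 (α q)) q.1
  snd : ∀ q ∈ Metric.ball ((1 : ℝ), (0 : ℝ)) η, HasDerivAt (fun t => α (q.1, t)) (β q) q.2
  fst' : ∀ q ∈ Metric.ball ((1 : ℝ), (0 : ℝ)) η,
    HasDerivAt (fun t => β (t, q.2)) (dF ψ q.1 (α q) * β q) q.1
  snd' : ∀ q ∈ Metric.ball ((1 : ℝ), (0 : ℝ)) η,
    HasDerivAt (fun t => β (q.1, t)) (dG ψ q.1 (α q) / 2) q.2
  sq_eq : ∀ q ∈ Metric.ball ((1 : ℝ), (0 : ℝ)) η, β q ^ 2 = G ψ q.1 (α q)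
  growth : ∀ q ∈ Metric.ball ((1 : ℝ), (0 : ℝ)) η, (q.1 - 1) ^ 2 + q.2 ^ 2 ≤ α q
  ne_zero : ∀ q ∈ Metric.ball ((1 : ℝ), (0 : ℝ)) η, q.2 ≠ 0 → β q ≠ 0

/-- The solution before its second equation is established: what the flow construction gives. -/
lemma IsPsi.exists_analyticAt_fst {ψ : ℝ → ℝ} {r : ℝ} (h : IsPsi ψ r) :
    ∃ (α : ℝ × ℝ → ℝ) (g : ℝ → ℝ), AnalyticAt ℝ α (1, 0) ∧ g 0 = 0 ∧
      deriv g 0 = 0 ∧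
      (∀ᶠ y in 𝓝 (0 : ℝ), HasDerivAt (deriv g) (dG ψ 1 (g y) / 2) y) ∧
      ∀ᶠ q in 𝓝 ((1 : ℝ), (0 : ℝ)), α (1, q.2) = g q.2 ∧
        HasDerivAt (fun t => α (t, q.2)) (F ψ q.1 (α q)) q.1 := by
  have hψ := h.analytic 0 h.zero_mem
  obtain ⟨V, hV, hV0, hVe⟩ := exists_analyticAt_flow hψ
  have hP : AnalyticAt ℝ (fun a => dG ψ 1 a / 2) 0 := by
    have h1 := hψ.deriv
    unfold dG dF F
    have h2 : AnalyticAt ℝ (fun a : ℝ => a) 0 := analyticAt_id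
    fun_prop
  obtain ⟨g, hg, hg0, hg1, hge⟩ := exists_analyticAt_second_order hP
  -- With `t = x² - 1` the equation `∂ₓα = 2x(x² - ψ(α))` becomes `∂ₜV = 1 + t - ψ(V)`, with initial
  -- value `g y` at `x = 1`.
  let κ : ℝ × ℝ → ℝ × ℝ := fun q => (q.1 ^ 2 - 1, g q.2)
  have hκ0 : κ (1, 0) = (0, 0) := by simp [κ, hg0]
  have hκ : AnalyticAt ℝ κ (1, 0) :=
    ((analyticAt_fst.fun_pow 2).fun_sub analyticAt_const).prod
      (AnalyticAt.comp (g := g) hg analyticAt_snd)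
  refine ⟨fun q => V (κ q), g, ?_, hg0, hg1, hge, ?_⟩
  · exact AnalyticAt.comp (g := V) (by rw [hκ0]; exact hV) hκ
  · have hκt : Tendsto κ (𝓝 (1, 0)) (𝓝 (0, 0)) := by
      have := hκ.continuousAt.tendsto
      rwa [hκ0] at this
    filter_upwards [hκt.eventually hVe] with q hq
    refine ⟨by simpa [κ] using hq.1, ?_⟩
    have h1 : HasDerivAt (fun t : ℝ => t ^ 2 - 1) (2 * q.1) q.1 := by
      simpa using (hasDerivAt_pow 2 q.1).sub_const 1
    convert! hq.2.comp q.1 h1 using 1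
    simp only [F, κ]
    ring

theorem IsPsi.exists_isProfile {ψ : ℝ → ℝ} {r : ℝ} (h : IsPsi ψ r) :
    ∃ (α β : ℝ × ℝ → ℝ) (η : ℝ), IsProfile ψ r α β η := by
  obtain ⟨α, g, hα, hg0, hg1, hge, hev⟩ := h.exists_analyticAt_fst
  have hα0 : α (1, 0) = 0 := by rw [(hev.self_of_nhds).1, hg0]
  have hz := h.zero_mem
  let β : ℝ × ℝ → ℝ := fun q => fderiv ℝ α q (0, 1)
  have hβan : ∀ q, AnalyticAt ℝ α q → AnalyticAt ℝ β q := fun q hq =>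
    ((ContinuousLinearMap.apply ℝ ℝ ((0 : ℝ), (1 : ℝ))).analyticAt _).comp hq.fderiv
  let γ : ℝ × ℝ → ℝ := fun q => fderiv ℝ β q (0, 1)
  have hγ : AnalyticAt ℝ γ (1, 0) :=
    ((ContinuousLinearMap.apply ℝ ℝ ((0 : ℝ), (1 : ℝ))).analyticAt _).comp (hβan _ hα).fderiv
  have hsec : Tendsto (fun y : ℝ => ((1 : ℝ), y)) (𝓝 0) (𝓝 (1, 0)) :=
    (Continuous.prodMk continuous_const continuous_id).tendsto 0
  have hβ1 : ∀ᶠ y in 𝓝 (0 : ℝ), β (1, y) = deriv g y := by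
    have h1 : ∀ᶠ y in 𝓝 (0 : ℝ), α (1, y) = g y := hsec.eventually (hev.mono fun q hq => hq.1)
    filter_upwards [h1.eventually_nhds, hsec.eventually hα.eventually_analyticAt] with y hy hay
    rw [show β (1, y) = deriv (fun t => α (1, t)) y from (hasDerivAt_snd_of_analyticAt hay).deriv.symm]
    exact Filter.EventuallyEq.deriv_eq hy
  have hψ0 := h.value
  have hψ1 := h.slope
  have hF0 : F ψ 1 0 = 0 := by simp [F, hψ0]
  -- On the line `x = 1`, `∂_y²α = dG/2`, and `dG ψ 1 0 = 12 - 4`.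
  have hγ0 : γ (1, 0) = 4 := by
    have h1 : HasDerivAt (fun t => β (1, t)) (dG ψ 1 (g 0) / 2) 0 :=
      hge.self_of_nhds.congr_of_eventuallyEq hβ1
    rw [show γ (1, 0) = _ from (hasDerivAt_snd_of_analyticAt (hβan _ hα)).unique h1, hg0]
    simp only [dG, hF0, hψ0]
    norm_num
  have hψα : ContinuousAt (fun q => ψ (α q)) (1, 0) :=
    ContinuousAt.comp (g := ψ) (by rw [hα0]; exact (h.analytic 0 hz).continuousAt) hα.continuousAt
  have hψα' : ContinuousAt (fun q => deriv ψ (α q)) (1, 0) :=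
    ContinuousAt.comp (g := deriv ψ) (by rw [hα0]; exact (h.analytic 0 hz).deriv.continuousAt)
      hα.continuousAt
  have hrange : ∀ᶠ q in 𝓝 ((1 : ℝ), (0 : ℝ)), α q ∈ Ioo (-r) r :=
    hα.continuousAt.eventually_mem (by rw [hα0]; exact isOpen_Ioo.mem_nhds hz)
  -- The value at `(1, 0)` is `3`; any bound would do for the linear equations below.
  have hdF : ∀ᶠ q in 𝓝 ((1 : ℝ), (0 : ℝ)), |2 * dF ψ q.1 (α q)| < 4 := by
    have h1 : ContinuousAt (fun q : ℝ × ℝ => |2 * dF ψ q.1 (α q)|) (1, 0) := by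
      unfold dF; fun_prop
    refine h1.eventually_lt_const ?_
    simp only [dF, hα0, hψ1]; norm_num
  have hdF' : ∀ᶠ q in 𝓝 ((1 : ℝ), (0 : ℝ)),
      2 < (-2 * ψ (α q) + 6 * q.1 ^ 2) * 1 + dF ψ q.1 (α q) * F ψ q.1 (α q) := by
    have h1 : ContinuousAt (fun q : ℝ × ℝ =>
        (-2 * ψ (α q) + 6 * q.1 ^ 2) * 1 + dF ψ q.1 (α q) * F ψ q.1 (α q)) (1, 0) := by
      have key : ∀ A B : ℝ × ℝ → ℝ, ContinuousAt A (1, 0) → ContinuousAt B (1, 0) →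
          ContinuousAt (fun q => (-2 * A q + 6 * q.1 ^ 2) * 1 +
            (-2 * q.1 * B q) * (-2 * q.1 * A q + 2 * q.1 ^ 3)) (1, 0) := by
        intro A B hA hB; fun_prop
      exact key _ _ hψα hψα'
    refine h1.eventually_const_lt ?_
    simp only [hα0, hψ0, hF0]; norm_num
  have hγ2 : ∀ᶠ q in 𝓝 ((1 : ℝ), (0 : ℝ)), 2 < γ q :=
    hγ.continuousAt.eventually_const_lt (by rw [hγ0]; norm_num)
  have hsnd : Tendsto (fun q : ℝ × ℝ => q.2) (𝓝 (1, 0)) (𝓝 0) := continuous_snd.tendsto _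
  obtain ⟨η₀, hη₀, hB⟩ := Metric.eventually_nhds_iff.1 (hev.and (hα.eventually_analyticAt.and
    (hrange.and (hdF.and (hdF'.and (hγ2.and (hsnd.eventually (hge.and hβ1))))))))
  obtain ⟨η, hη, hη1, hηη₀⟩ : ∃ η, 0 < η ∧ η < 1 ∧ η ≤ η₀ :=
    ⟨min η₀ (1 / 2), by positivity, (min_le_right _ _).trans_lt (by norm_num), min_le_left _ _⟩
  -- In the sup metric the ball is a product of intervals, so arguments along coordinate lines stay
  -- inside it.
  have hball : ∀ {x y : ℝ}, (x, y) ∈ Metric.ball ((1 : ℝ), (0 : ℝ)) η ↔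
      x ∈ Ioo (1 - η) (1 + η) ∧ y ∈ Ioo (0 - η) (0 + η) := by
    intro x y
    rw [← ball_prod_same, mem_prod, Real.ball_eq_Ioo, Real.ball_eq_Ioo]
  have h1m : (1 : ℝ) ∈ Ioo (1 - η) (1 + η) := ⟨by linarith, by linarith⟩
  have h0m : (0 : ℝ) ∈ Ioo (0 - η) (0 + η) := ⟨by linarith, by linarith⟩
  have H : ∀ {x y : ℝ}, x ∈ Ioo (1 - η) (1 + η) → y ∈ Ioo (0 - η) (0 + η) →
      dist (x, y) ((1 : ℝ), (0 : ℝ)) < η₀ := fun hx hy =>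
    (Metric.mem_ball.1 (hball.2 ⟨hx, hy⟩)).trans_le hηη₀
  have han : ∀ {x y : ℝ}, x ∈ Ioo (1 - η) (1 + η) → y ∈ Ioo (0 - η) (0 + η) →
      AnalyticAt ℝ α (x, y) := fun hx hy => (hB (H hx hy)).2.1
  have hran : ∀ {x y : ℝ}, x ∈ Ioo (1 - η) (1 + η) → y ∈ Ioo (0 - η) (0 + η) →
      α (x, y) ∈ Ioo (-r) r := fun hx hy => (hB (H hx hy)).2.2.1
  have hfst : ∀ {x y : ℝ}, x ∈ Ioo (1 - η) (1 + η) → y ∈ Ioo (0 - η) (0 + η) →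
      HasDerivAt (fun t => α (t, y)) (F ψ x (α (x, y))) x := fun hx hy => (hB (H hx hy)).1.2
  have hsndd : ∀ {x y : ℝ}, x ∈ Ioo (1 - η) (1 + η) → y ∈ Ioo (0 - η) (0 + η) →
      HasDerivAt (fun t => α (x, t)) (β (x, y)) y := fun hx hy =>
    hasDerivAt_snd_of_analyticAt (han hx hy)
  have hγd : ∀ {x y : ℝ}, x ∈ Ioo (1 - η) (1 + η) → y ∈ Ioo (0 - η) (0 + η) →
      HasDerivAt (fun t => β (x, t)) (γ (x, y)) y := fun hx hy =>
    hasDerivAt_snd_of_analyticAt (hβan _ (han hx hy))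
  have hfst' : ∀ {x y : ℝ}, x ∈ Ioo (1 - η) (1 + η) → y ∈ Ioo (0 - η) (0 + η) →
      HasDerivAt (fun t => β (t, y)) (dF ψ x (α (x, y)) * β (x, y)) x := by
    intro x y hx hy
    obtain ⟨m, hm1, hm2⟩ := exists_hasDerivAt_mixed (han hx hy)
    have h2 : HasDerivAt (fun t => fderiv ℝ α (x, t) (1, 0))
        ((-2 * ψ (α (x, y)) + 6 * x ^ 2) * 0 + dF ψ x (α (x, y)) * β (x, y)) y := by
      refine (h.hasDerivAt_F (hran hx hy) (hasDerivAt_const y x)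
        (hsndd hx hy)).congr_of_eventuallyEq ?_
      filter_upwards [isOpen_Ioo.mem_nhds hy] with t ht
      exact (hasDerivAt_fst_of_analyticAt (han hx ht)).unique (hfst hx ht)
    have h3 := hm2.unique h2
    rw [mul_zero, zero_add] at h3
    rwa [← h3]
  -- the energy identity on the line `x = 1`
  have hline : ∀ y ∈ Ioo (0 - η) (0 + η), β (1, y) ^ 2 - G ψ 1 (α (1, y)) = 0 := by
    refine eq_zero_of_linear_ode (c := fun _ => 0) (K := 0) hη (by simp) ?_ ?_
    · intro y hy
      have hd := hsndd h1m hy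
      have hb : HasDerivAt (fun t => β (1, t)) (dG ψ 1 (α (1, y)) / 2) y := by
        rw [(hB (H h1m hy)).1.1]
        refine (hB (H h1m hy)).2.2.2.2.2.2.1.congr_of_eventuallyEq ?_
        filter_upwards [isOpen_Ioo.mem_nhds hy] with t ht using (hB (H h1m ht)).2.2.2.2.2.2.2
      convert! (hb.pow 2).sub (h.hasDerivAt_G (hran h1m hy) (hasDerivAt_const y 1) hd) using 1
      simp
      ring
    · have : β (1, 0) = 0 := by rw [hβ1.self_of_nhds, hg1]
      rw [this, hα0]
      simp [G, hF0, SteadyEuler.H]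
  -- By compatibility, `e = β² - G` satisfies `∂ₓe = 2 dF e`, and `e = 0` on `x = 1`.
  have hsq : ∀ {x y : ℝ}, x ∈ Ioo (1 - η) (1 + η) → y ∈ Ioo (0 - η) (0 + η) →
      β (x, y) ^ 2 = G ψ x (α (x, y)) := by
    intro x y hx hy
    refine sub_eq_zero.1 (eq_zero_of_linear_ode (e := fun x => β (x, y) ^ 2 - G ψ x (α (x, y)))
      (c := fun x => 2 * dF ψ x (α (x, y))) (K := 4) hη
      (fun t ht => (hB (H ht hy)).2.2.2.1.le) ?_ (hline y hy) x hx)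
    intro t ht
    convert! ((hfst' ht hy).pow 2).sub
      (h.hasDerivAt_G (hran ht hy) (hasDerivAt_id t) (hfst ht hy)) using 1
    have := h.compatibility (hran ht hy) t
    simp
    linear_combination this
  have haxis : ∀ x ∈ Ioo (1 - η) (1 + η), β (x, 0) = 0 := by
    refine eq_zero_of_linear_ode (e := fun x => β (x, 0)) (c := fun x => dF ψ x (α (x, 0)))
      (K := 4) hη ?_ (fun x hx => hfst' hx h0m) (by rw [hβ1.self_of_nhds, hg1])
    intro x hx
    have := (hB (H hx h0m)).2.2.2.1
    rw [abs_mul, abs_two] at this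
    linarith [abs_nonneg (dF ψ x (α (x, 0)))]
  -- `β` vanishes at `y = 0` and increases strictly in `y`, since `∂_yβ = γ > 2`.
  have hne : ∀ {x y : ℝ}, x ∈ Ioo (1 - η) (1 + η) → y ∈ Ioo (0 - η) (0 + η) → y ≠ 0 →
      β (x, y) ≠ 0 := by
    intro x y hx hy hy0 hβ0
    have hmono : StrictMonoOn (fun t => β (x, t)) (Ioo (0 - η) (0 + η)) := by
      refine strictMonoOn_of_deriv_pos (convex_Ioo _ _)
        (fun t ht => (hγd hx ht).continuousAt.continuousWithinAt) ?_
      rw [interior_Ioo]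
      intro t ht
      rw [(hγd hx ht).deriv]
      linarith [(hB (H hx ht)).2.2.2.2.2.1]
    exact hy0 (hmono.injOn hy h0m (by simp only [hβ0, haxis x hx]))
  -- Differentiating `β² = G` in `y` gives `2βγ = dG β`; division by `β` is possible off `y = 0`,
  -- and continuity covers `y = 0` afterwards.
  have hγeq' : ∀ {x y : ℝ}, x ∈ Ioo (1 - η) (1 + η) → y ∈ Ioo (0 - η) (0 + η) → y ≠ 0 →
      γ (x, y) = dG ψ x (α (x, y)) / 2 := by
    intro x y hx hy hy0
    have h1 := (hγd hx hy).pow 2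
    have h2 := h.hasDerivAt_G (hran hx hy) (hasDerivAt_const y x) (hsndd hx hy)
    have h3 := h1.unique (h2.congr_of_eventuallyEq (by
      filter_upwards [isOpen_Ioo.mem_nhds hy] with t ht using hsq hx ht))
    simp only [mul_zero, zero_add] at h3
    have h4 := hne hx hy hy0
    have h5 : β (x, y) * (2 * γ (x, y) - dG ψ x (α (x, y))) = 0 := by
      simp at h3
      linear_combination h3
    have := (mul_eq_zero.1 h5).resolve_left h4
    linarith
  have hγeq : ∀ {x y : ℝ}, x ∈ Ioo (1 - η) (1 + η) → y ∈ Ioo (0 - η) (0 + η) →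
      γ (x, y) = dG ψ x (α (x, y)) / 2 := by
    intro x y hx hy
    rcases eq_or_ne y 0 with rfl | hy0
    · have hc1 : ContinuousAt (fun t => γ (x, t)) 0 := by
        have : AnalyticAt ℝ γ (x, 0) :=
          ((ContinuousLinearMap.apply ℝ ℝ ((0 : ℝ), (1 : ℝ))).analyticAt _).comp
            (hβan _ (han hx hy)).fderiv
        exact ContinuousAt.comp (f := fun t => (x, t)) this.continuousAt (by fun_prop)
      have hc2 : ContinuousAt (fun t => dG ψ x (α (x, t)) / 2) 0 := by
        have ha : ContinuousAt (fun t => α (x, t)) 0 := (hsndd hx hy).continuousAt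
        have hp : ContinuousAt (fun t => ψ (α (x, t))) 0 :=
          ContinuousAt.comp (g := ψ) (h.hasDerivAt (hran hx hy)).continuousAt ha
        have hp' : ContinuousAt (fun t => deriv ψ (α (x, t))) 0 :=
          ContinuousAt.comp (g := deriv ψ) (h.analytic _ (hran hx hy)).deriv.continuousAt ha
        have key : ∀ A B C : ℝ → ℝ, ContinuousAt A 0 → ContinuousAt B 0 → ContinuousAt C 0 →
            ContinuousAt (fun t => 12 * x ^ 2 - 2 * (-2 * x * A t + 2 * x ^ 3) * (-2 * x * B t) -
              (4 * A t + 24 * C t * B t)) 0 := by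
          intro A B C hA hB hC; fun_prop
        exact (key _ _ _ hp hp' ha).div_const 2
      refine tendsto_nhds_unique (f := fun t => γ (x, t)) (l := 𝓝[≠] 0)
        (hc1.tendsto.mono_left nhdsWithin_le_nhds)
        ((hc2.tendsto.mono_left nhdsWithin_le_nhds).congr' ?_)
      filter_upwards [self_mem_nhdsWithin, nhdsWithin_le_nhds (isOpen_Ioo.mem_nhds hy)]
        with t ht0 ht
      exact (hγeq' hx ht ht0).symm
    · exact hγeq' hx hy hy0
  -- Growth in `y` from the critical point `(x, 0)`, then in `x` along `y = 0` from `(1, 0)`.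
  have hgrow : ∀ {x y : ℝ}, x ∈ Ioo (1 - η) (1 + η) → y ∈ Ioo (0 - η) (0 + η) →
      (x - 1) ^ 2 + y ^ 2 ≤ α (x, y) := by
    intro x y hx hy
    have h1 := sq_add_le_of_two_le_deriv hη (fun t ht => hsndd hx ht) (fun t ht => hγd hx ht)
      (fun t ht => (hB (H hx ht)).2.2.2.2.2.1.le) (haxis x hx) y hy
    have h2 := sq_add_le_of_two_le_deriv hη (fun t ht => hfst ht h0m)
      (fun t ht => h.hasDerivAt_F (hran ht h0m) (hasDerivAt_id t) (hfst ht h0m))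
      (fun t ht => (hB (H ht h0m)).2.2.2.2.1.le) (by rw [hα0, hF0]) x hx
    rw [hα0] at h2
    rw [sub_zero] at h1
    linarith
  refine ⟨α, β, η, hη, hη1, hα0, ?_, ?_, ?_, ?_, ?_, ?_, ?_, ?_, ?_, ?_⟩ <;> rintro ⟨x, y⟩ hq <;>
    obtain ⟨hx, hy⟩ := hball.1 hq
  · exact hran hx hy
  · exact han hx hy
  · exact hβan _ (han hx hy)
  · exact hfst hx hy
  · exact hsndd hx hy
  · exact hfst' hx hy
  · have := hγd hx hy
    rwa [hγeq hx hy] at this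
  · exact hsq hx hy
  · exact hgrow hx hy
  · exact hne hx hy

/-! ### The Euler equations in Cartesian coordinates. -/

/-- The `i`-th coordinate as a continuous linear functional. -/
noncomputable abbrev dx (i : Fin 3) : E3 →L[ℝ] ℝ := EuclideanSpace.proj i

lemma hasFDerivAt_coord (i : Fin 3) (x : E3) : HasFDerivAt (fun y : E3 => y i) (dx i) x :=
  (dx i).hasFDerivAt

lemma fderiv_apply_coord {u : E3 → E3} {x : E3} {L : Fin 3 → E3 →L[ℝ] ℝ}
    (h : ∀ i, HasFDerivAt (fun y => u y i) (L i) x) (v : E3) (i : Fin 3) :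
    fderiv ℝ u x v i = L i v := by
  have hu : DifferentiableAt ℝ u x :=
    (differentiableAt_euclidean).2 fun i => (h i).differentiableAt
  have h1 := (dx i).hasFDerivAt.comp x hu.hasFDerivAt
  exact congrArg (fun M : E3 →L[ℝ] ℝ => M v) (h1.unique (h i))

lemma gradient_apply_coord (p : E3 → ℝ) (x : E3) (i : Fin 3) :
    gradient p x i = fderiv ℝ p x (EuclideanSpace.single i 1) := by
  have h : inner ℝ (gradient p x) (EuclideanSpace.single i (1 : ℝ))
      = fderiv ℝ p x (EuclideanSpace.single i 1) := by
    simp [gradient]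
  rw [← h, EuclideanSpace.inner_single_right]
  simp

lemma inner_gradient (p : E3 → ℝ) (x v : E3) : inner ℝ v (gradient p x) = fderiv ℝ p x v := by
  rw [real_inner_comm]
  simp [gradient]

/-- The velocity with angular momentum `b` whose stream function has the gradient
`(m x₀, m x₁, q)`, in Cartesian coordinates. -/
noncomputable def cartesianVelocity (q b m : E3 → ℝ) (x : E3) : E3 :=
  !₂[(q x * x 0 - b x * x 1) / (x 0 ^ 2 + x 1 ^ 2), (q x * x 1 + b x * x 0) / (x 0 ^ 2 + x 1 ^ 2),
    -m x]

/-- The linear functional with coefficients `(m x₀, m x₁, q)`. -/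
noncomputable def axisForm (x : E3) (m q : ℝ) : E3 →L[ℝ] ℝ :=
  (m * x 0) • dx 0 + (m * x 1) • dx 1 + q • dx 2

/-- The first order relations at a point between a pressure `p` and the functions `q`, `b`, `m`
that make the Cartesian velocity a steady Euler flow with `|u|² = 3 p`. -/
structure EulerRelations (p q b m : E3 → ℝ) (A B C : ℝ) (x : E3) : Prop where
  off_axis : x 0 ^ 2 + x 1 ^ 2 ≠ 0
  hasFDerivAt_p : HasFDerivAt p (axisForm x (m x) (q x)) x
  hasFDerivAt_q : HasFDerivAt q (axisForm x (-(A * q x)) B) x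
  hasFDerivAt_b : HasFDerivAt b (C • axisForm x (m x) (q x)) x
  hasFDerivAt_m : HasFDerivAt m (axisForm x 1 0 - A • axisForm x (m x) (q x)) x
  energy : q x ^ 2 + b x ^ 2 + m x ^ 2 * (x 0 ^ 2 + x 1 ^ 2) = 3 * p x * (x 0 ^ 2 + x 1 ^ 2)
  balance : -(A * q x ^ 2) - B * m x = 3 * p x - m x ^ 2 - m x * (x 0 ^ 2 + x 1 ^ 2)

namespace EulerRelations

variable {p q b m : E3 → ℝ} {A B C : ℝ} {x : E3}

/-- The derivatives of the components of the Cartesian velocity. -/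
lemma hasFDerivAt_velocity (h : EulerRelations p q b m A B C x) (i : Fin 3) :
    HasFDerivAt (fun y => cartesianVelocity q b m y i)
      ((![(x 0 ^ 2 + x 1 ^ 2)⁻¹ • (q x • dx 0 + x 0 • axisForm x (-(A * q x)) B
            - (b x • dx 1 + x 1 • C • axisForm x (m x) (q x)))
          - ((q x * x 0 - b x * x 1) / (x 0 ^ 2 + x 1 ^ 2) ^ 2) • (axisForm x 2 0),
        (x 0 ^ 2 + x 1 ^ 2)⁻¹ • (q x • dx 1 + x 1 • axisForm x (-(A * q x)) B
            + (b x • dx 0 + x 0 • C • axisForm x (m x) (q x)))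
          - ((q x * x 1 + b x * x 0) / (x 0 ^ 2 + x 1 ^ 2) ^ 2) • (axisForm x 2 0),
        -(axisForm x 1 0 - A • axisForm x (m x) (q x))] : Fin 3 → E3 →L[ℝ] ℝ) i) x := by
  have h0 := hasFDerivAt_coord 0 x
  have h1 := hasFDerivAt_coord 1 x
  have hs := (h0.pow 2).add (h1.pow 2)
  have hs' := (hasDerivAt_inv h.off_axis).comp_hasFDerivAt x hs
  have hne := h.off_axis
  fin_cases i
  · convert! ((h.hasFDerivAt_q.mul h0).sub (h.hasFDerivAt_b.mul h1)).mul hs' using 1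
    ext v
    simp [axisForm]
    field_simp
    ring
  · convert! ((h.hasFDerivAt_q.mul h1).add (h.hasFDerivAt_b.mul h0)).mul hs' using 1
    ext v
    simp [axisForm]
    field_simp
    ring
  · exact h.hasFDerivAt_m.neg

lemma fderiv_pressure_velocity (h : EulerRelations p q b m A B C x) :
    fderiv ℝ p x (cartesianVelocity q b m x) = 0 := by
  have := h.off_axis
  rw [h.hasFDerivAt_p.fderiv]
  simp [axisForm, cartesianVelocity]
  field_simp
  ring

lemma norm_sq (h : EulerRelations p q b m A B C x) :
    ‖cartesianVelocity q b m x‖ ^ 2 = 3 * p x := by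
  have := h.off_axis
  rw [EuclideanSpace.norm_sq_eq]
  simp [Fin.sum_univ_three, cartesianVelocity]
  field_simp
  linear_combination (x 0 ^ 2 + x 1 ^ 2) * h.energy

/-- The axial component follows from the derivative relations alone. The horizontal ones also need
`balance`, with `3p` expressed through `energy`. -/
lemma convective_eq (h : EulerRelations p q b m A B C x) :
    convective (cartesianVelocity q b m) x = -gradient p x := by
  have hne := h.off_axis
  ext i
  rw [convective, fderiv_apply_coord h.hasFDerivAt_velocity, PiLp.neg_apply, gradient_apply_coord,
    h.hasFDerivAt_p.fderiv]
  have h1 := h.energy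
  have h2 := h.balance
  fin_cases i
  · simp [axisForm, cartesianVelocity]
    field_simp
    linear_combination (x 0 * (x 0 ^ 2 + x 1 ^ 2) ^ 2) * h2 - (x 0 * (x 0 ^ 2 + x 1 ^ 2)) * h1
  · simp [axisForm, cartesianVelocity]
    field_simp
    linear_combination (x 1 * (x 0 ^ 2 + x 1 ^ 2) ^ 2) * h2 - (x 1 * (x 0 ^ 2 + x 1 ^ 2)) * h1
  · simp [axisForm, cartesianVelocity]
    field_simp
    ring

/-- The mixed derivatives of the stream function cancel, as the same `A` occurs in the relations for
`q` and `m`; the swirl contributes nothing because `db` is a multiple of the rotationally invariant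
`dp`. -/
lemma divergence_eq (h : EulerRelations p q b m A B C x) :
    divergence (cartesianVelocity q b m) x = 0 := by
  have hne := h.off_axis
  simp only [divergence, fderiv_apply_coord h.hasFDerivAt_velocity, Fin.sum_univ_three]
  simp [axisForm]
  field_simp
  ring

end EulerRelations

/-! ### The intermediate flow around the circle. -/

/-- The rescaled cylindrical coordinates `(ρ / R, z / R)`. -/
noncomputable def meridian (R : ℝ) (x : E3) : ℝ × ℝ := (rho x / R, x 2 / R)

lemma rho_sq (x : E3) : rho x ^ 2 = x 0 ^ 2 + x 1 ^ 2 := Real.sq_sqrt (by positivity)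

lemma continuous_rho : Continuous rho := by unfold rho; fun_prop

lemma continuous_meridian (R : ℝ) : Continuous (meridian R) := by
  have := continuous_rho
  unfold meridian
  fun_prop

lemma isOpen_region {U : Set (ℝ × ℝ)} (hU : IsOpen U) (R : ℝ) : IsOpen (region U R) :=
  hU.preimage (continuous_meridian R)

lemma contDiffAt_rho {x : E3} (hx : rho x ≠ 0) : ContDiffAt ℝ ω rho x := by
  unfold rho
  refine ContDiffAt.sqrt (by fun_prop) ?_
  rw [← rho_sq]
  exact pow_ne_zero 2 hx

lemma hasFDerivAt_rho {x : E3} (hx : rho x ≠ 0) :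
    HasFDerivAt rho (axisForm x (1 / rho x) 0) x := by
  have hs := ((hasFDerivAt_coord 0 x).pow 2).add ((hasFDerivAt_coord 1 x).pow 2)
  have h1 := hs.sqrt (by
    simp only [Pi.add_apply]
    rw [← rho_sq]; exact pow_ne_zero 2 hx)
  convert! h1 using 1
  ext v
  simp [axisForm, rho] at hx ⊢
  field_simp

section

variable {R : ℝ} {x : E3}

lemma contDiffAt_comp_meridian {k : ℝ × ℝ → ℝ} (hx : rho x ≠ 0)
    (hk : AnalyticAt ℝ k (meridian R x)) : ContDiffAt ℝ ω (fun y => k (meridian R y)) x := by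
  have h1 : ContDiffAt ℝ ω (meridian R) x := by
    have := contDiffAt_rho hx
    unfold meridian
    refine ContDiffAt.prodMk (by fun_prop) (by fun_prop)
  exact ContDiffAt.comp x hk.contDiffAt h1

lemma hasFDerivAt_comp_meridian {k : ℝ × ℝ → ℝ} {k₁ k₂ : ℝ} (hx : rho x ≠ 0)
    (hk : AnalyticAt ℝ k (meridian R x))
    (h₁ : HasDerivAt (fun t => k (t, (meridian R x).2)) k₁ (meridian R x).1)
    (h₂ : HasDerivAt (fun t => k ((meridian R x).1, t)) k₂ (meridian R x).2) :
    HasFDerivAt (fun y => k (meridian R y)) (axisForm x (k₁ / (R * rho x)) (k₂ / R)) x := by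
  have hm : HasFDerivAt (meridian R)
      ((R⁻¹ • axisForm x (1 / rho x) 0).prod (R⁻¹ • dx 2)) x := by
    have h1 := (hasFDerivAt_rho hx).const_smul (R⁻¹)
    have h2 := (hasFDerivAt_coord 2 x).const_smul (R⁻¹)
    convert! h1.prodMk h2 using 1
    ext y <;> simp [meridian, div_eq_inv_mul]
  have hk1 := (hasDerivAt_fst_of_analyticAt (x := (meridian R x).1) (y := (meridian R x).2)
    hk).unique h₁
  have hk2 := (hasDerivAt_snd_of_analyticAt (x := (meridian R x).1) (y := (meridian R x).2)
    hk).unique h₂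
  convert! hk.differentiableAt.hasFDerivAt.comp x hm using 1
  ext v
  have hsplit : ∀ s t : ℝ, fderiv ℝ k (meridian R x) (s, t) = s * k₁ + t * k₂ := fun s t => by
    rw [← hk1, ← hk2]
    have : ((s, t) : ℝ × ℝ) = s • (1, 0) + t • (0, 1) := by simp
    rw [this, map_add, map_smul, map_smul]
    rfl
  simp only [ContinuousLinearMap.comp_apply, ContinuousLinearMap.prod_apply, hsplit]
  simp [axisForm]
  field_simp

end

/-- `∂_z p` for the pressure `p` of the intermediate flow. -/
noncomputable def axialSlope (β : ℝ × ℝ → ℝ) (R : ℝ) (x : E3) : ℝ := R ^ 3 / 4 * β (meridian R x)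

/-- `ρ⁻¹ ∂_ρ p` for the pressure `p` of the intermediate flow. -/
noncomputable def radialSlope (ψ : ℝ → ℝ) (α : ℝ × ℝ → ℝ) (R : ℝ) (x : E3) : ℝ :=
  R ^ 2 / 2 * ((x 0 ^ 2 + x 1 ^ 2) / R ^ 2 - ψ (α (meridian R x)))

section

variable {ψ : ℝ → ℝ} {r η R : ℝ} {α β : ℝ × ℝ → ℝ} {x : E3}

lemma IsProfile.rho_pos (hp : IsProfile ψ r α β η) (hR : 0 < R)
    (hx : x ∈ region (Metric.ball (1, 0) η) R) : 0 < rho x := by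
  have h1 : (rho x / R, x 2 / R) ∈ Metric.ball ((1 : ℝ), (0 : ℝ)) η := hx
  rw [← ball_prod_same, mem_prod, Real.ball_eq_Ioo] at h1
  have h2 : 0 < rho x / R := by linarith [h1.1.1, hp.lt_one]
  exact (div_pos_iff_of_pos_right hR).1 h2

lemma IsProfile.alpha_pos (hp : IsProfile ψ r α β η) (hR : 0 < R)
    (hx : x ∈ region (Metric.ball (1, 0) η) R \ circleR R) : 0 < α (meridian R x) := by
  have h1 := hp.growth _ hx.1
  refine lt_of_lt_of_le ?_ h1
  by_contra hcon
  push Not at hcon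
  have h2 : rho x / R - 1 = 0 := by nlinarith [sq_nonneg (rho x / R - 1), sq_nonneg (x 2 / R)]
  have h3 : x 2 / R = 0 := by nlinarith [sq_nonneg (rho x / R - 1), sq_nonneg (x 2 / R)]
  refine hx.2 ⟨?_, ?_⟩
  · field_simp at h2; linarith
  · field_simp at h3; linarith

/-- Since `F` is divisible by `x`, the quotient `ρ⁻¹ ∂_ρ p` is a polynomial in `x₀`, `x₁` minus a
multiple of `ψ(α)`, so the Cartesian form contains no square root of `x₀² + x₁²` besides those
inside `α`, `β`. -/
lemma IsProfile.velocity_eq (hp : IsProfile ψ r α β η) (hR : 0 < R)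
    (hx : x ∈ region (Metric.ball (1, 0) η) R) :
    velocity ψ α R x
      = cartesianVelocity (axialSlope β R) (swirl ψ α R) (radialSlope ψ α R) x := by
  have hρ := (hp.rho_pos hR hx).ne'
  have h1 : HasDerivAt (fun z => pressureProfile α R (rho x) z)
      (R ^ 4 / 4 * (β (meridian R x) * (1 / R))) (x 2) :=
    ((hp.snd _ hx).comp (x 2) ((hasDerivAt_id (x 2)).div_const R)).const_mul (R ^ 4 / 4)
  have h2 : HasDerivAt (fun ρ => pressureProfile α R ρ (x 2))
      (R ^ 4 / 4 * (F ψ (rho x / R) (α (meridian R x)) * (1 / R))) (rho x) :=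
    ((hp.fst _ hx).comp (rho x) ((hasDerivAt_id (rho x)).div_const R)).const_mul (R ^ 4 / 4)
  rw [velocity, h1.deriv, h2.deriv]
  ext i
  simp only [cartesianVelocity, ← rho_sq, axialSlope, radialSlope, F]
  fin_cases i
  · simp [eRho, ePhi, eZ]
    field_simp
    ring
  · simp [eRho, ePhi, eZ]
    field_simp
  · simp [eRho, ePhi, eZ]
    field_simp
    ring

lemma swirl_eq (ψ : ℝ → ℝ) (α : ℝ × ℝ → ℝ) (R : ℝ) (x : E3) :
    swirl ψ α R x = R ^ 3 / 4 * Real.sqrt (H ψ (α (meridian R x))) := rfl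

lemma IsProfile.H_pos (hp : IsProfile ψ r α β η) (hR : 0 < R)
    (hH : ∀ a ∈ Ioo (-r) r, 0 < 1 / deriv ψ a + 2 * ψ a)
    (hx : x ∈ region (Metric.ball (1, 0) η) R \ circleR R) : 0 < H ψ (α (meridian R x)) :=
  mul_pos (mul_pos (by norm_num) (hp.alpha_pos hR hx)) (hH _ (hp.range _ hx.1))

/-- The pressure of the intermediate flow satisfies the Euler relations off the circle. -/
theorem IsProfile.eulerRelations (h : IsPsi ψ r) (hp : IsProfile ψ r α β η) (hR : 0 < R)
    (hH : ∀ a ∈ Ioo (-r) r, 0 < 1 / deriv ψ a + 2 * ψ a)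
    (hx : x ∈ region (Metric.ball (1, 0) η) R \ circleR R) :
    ∃ A B C, EulerRelations (pressure α R) (axialSlope β R) (swirl ψ α R) (radialSlope ψ α R)
      A B C x := by
  have hρ := (hp.rho_pos hR hx.1).ne'
  have hRne := hR.ne'
  have hr : α (meridian R x) ∈ Ioo (-r) r := hp.range _ hx.1
  have hHpos := hp.H_pos hR hH hx
  have hslope := h.slope_ne _ hr
  have hsq : β (meridian R x) ^ 2 = G ψ (rho x / R) (α (meridian R x)) := hp.sq_eq _ hx.1
  have hpress : pressure α R x = R ^ 4 / 4 * α (meridian R x) := rfl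
  have hcirc : x 0 ^ 2 + x 1 ^ 2 = rho x ^ 2 := (rho_sq x).symm
  have hda : HasFDerivAt (fun y => α (meridian R y))
      ((4 / R ^ 4) • axisForm x (radialSlope ψ α R x) (axialSlope β R x)) x := by
    convert! hasFDerivAt_comp_meridian hρ (hp.analytic _ hx.1) (hp.fst _ hx.1)
      (hp.snd _ hx.1) using 1
    ext v
    simp [axisForm, radialSlope, axialSlope, F, hcirc, meridian]
    field_simp
    ring
  -- `A` comes from `dm = ρ dρ - (R²/2) ψ' dα` with `dα = (4/R⁴) dp`, `B = ∂_z q` from `∂_yβ =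
  -- dG/2`, and `C = db/dp` from `b = (R³/4)√H`.
  refine ⟨2 * deriv ψ (α (meridian R x)) / R ^ 2,
    R ^ 2 / 8 * dG ψ (rho x / R) (α (meridian R x)),
    R ^ 3 / 4 * ((1 / (2 * Real.sqrt (H ψ (α (meridian R x))))) *
      ((4 * ψ (α (meridian R x)) + 24 * α (meridian R x) * deriv ψ (α (meridian R x)))
        * (4 / R ^ 4))), ?_, ?_, ?_, ?_, ?_, ?_, ?_⟩
  · rw [hcirc]; exact pow_ne_zero 2 hρ
  · convert! hda.const_smul (R ^ 4 / 4) using 1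
    rw [smul_smul, show R ^ 4 / 4 * (4 / R ^ 4) = 1 by field_simp, one_smul]
  · convert! (hasFDerivAt_comp_meridian hρ (hp.analytic' _ hx.1) (hp.fst' _ hx.1)
      (hp.snd' _ hx.1)).const_smul (R ^ 3 / 4) using 1
    ext v
    simp [axisForm, axialSlope, dF, meridian]
    field_simp
    ring
  · have h1 := h.hasDerivAt_H hr
    have h0 := h1.comp_hasFDerivAt x hda
    have h2 := h0.sqrt hHpos.ne'
    convert! h2.const_smul (R ^ 3 / 4) using 1
    simp only [smul_smul]
    rfl
  · have h0 := ((hasFDerivAt_coord 0 x).pow 2).add ((hasFDerivAt_coord 1 x).pow 2)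
    convert! ((h0.const_smul (R ^ 2)⁻¹).sub
      ((h.hasDerivAt hr).comp_hasFDerivAt x hda)).const_smul (R ^ 2 / 2) using 1
    · ext y
      simp [radialSlope, div_eq_inv_mul, mul_add]
    · ext v
      simp [axisForm]
      field_simp
      ring
  · rw [swirl_eq, mul_pow (R ^ 3 / 4), Real.sq_sqrt hHpos.le, axialSlope, mul_pow, hsq, hcirc,
      radialSlope, hcirc, hpress]
    simp only [G, F]
    field_simp
    ring
  · rw [axialSlope, mul_pow, hsq, radialSlope, hcirc, hpress]
    simp only [G, dG, dF, F, H]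
    field_simp
    ring

lemma IsProfile.contDiffAt_pressure (hp : IsProfile ψ r α β η) (hR : 0 < R)
    (hx : x ∈ region (Metric.ball (1, 0) η) R) : ContDiffAt ℝ ω (pressure α R) x :=
  contDiffAt_const.mul (contDiffAt_comp_meridian (hp.rho_pos hR hx).ne' (hp.analytic _ hx))

/-- The circle is excluded because `H` vanishes there and the square root is not smooth at `0`. -/
lemma IsProfile.contDiffAt_velocity (h : IsPsi ψ r) (hp : IsProfile ψ r α β η) (hR : 0 < R)
    (hH : ∀ a ∈ Ioo (-r) r, 0 < 1 / deriv ψ a + 2 * ψ a)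
    (hx : x ∈ region (Metric.ball (1, 0) η) R \ circleR R) :
    ContDiffAt ℝ ω (velocity ψ α R) x := by
  have hρ := (hp.rho_pos hR hx.1).ne'
  have hr := hp.range _ hx.1
  have heq : velocity ψ α R =ᶠ[𝓝 x]
      cartesianVelocity (axialSlope β R) (swirl ψ α R) (radialSlope ψ α R) := by
    filter_upwards [(isOpen_region Metric.isOpen_ball R).mem_nhds hx.1] with y hy
      using hp.velocity_eq hR hy
  refine ContDiffAt.congr_of_eventuallyEq ?_ heq
  have hα : ContDiffAt ℝ ω (fun y => α (meridian R y)) x :=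
    contDiffAt_comp_meridian hρ (hp.analytic _ hx.1)
  have hq : ContDiffAt ℝ ω (axialSlope β R) x :=
    contDiffAt_const.mul (contDiffAt_comp_meridian hρ (hp.analytic' _ hx.1))
  have hb : ContDiffAt ℝ ω (swirl ψ α R) x :=
    contDiffAt_const.mul (ContDiffAt.sqrt
      (ContDiffAt.comp x (g := H ψ) (h.analyticAt_H hr).contDiffAt hα) (hp.H_pos hR hH hx).ne')
  have hψ : ContDiffAt ℝ ω (fun y => ψ (α (meridian R y))) x :=
    ContDiffAt.comp x (g := ψ) (h.analytic _ hr).contDiffAt hα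
  have hm : ContDiffAt ℝ ω (radialSlope ψ α R) x := by
    refine contDiffAt_const.mul (ContDiffAt.sub (ContDiffAt.div_const ?_ _) hψ)
    fun_prop
  have hne : x 0 ^ 2 + x 1 ^ 2 ≠ 0 := by rw [← rho_sq]; exact pow_ne_zero 2 hρ
  rw [contDiffAt_euclidean]
  intro i
  fin_cases i <;> simp only [cartesianVelocity]
  · exact ContDiffAt.div (f := fun x => axialSlope β R x * x 0 - swirl ψ α R x * x 1)
      (by fun_prop) (by fun_prop) hne
  · exact ContDiffAt.div (f := fun x => axialSlope β R x * x 1 + swirl ψ α R x * x 0)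
      (by fun_prop) (by fun_prop) hne
  · exact hm.neg

/-- The intermediate flow. -/
theorem IsProfile.isSteadyEulerOn (h : IsPsi ψ r) (hp : IsProfile ψ r α β η) (hR : 0 < R)
    (hH : ∀ a ∈ Ioo (-r) r, 0 < 1 / deriv ψ a + 2 * ψ a) :
    IsSteadyEulerOn (velocity ψ α R) (pressure α R)
      (region (Metric.ball (1, 0) η) R \ circleR R) ∧
    ∀ x ∈ region (Metric.ball (1, 0) η) R \ circleR R,
      inner ℝ (velocity ψ α R x) (gradient (pressure α R) x) = 0 ∧
      ‖velocity ψ α R x‖ ^ 2 = 3 * pressure α R x := by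
  have heq : ∀ x ∈ region (Metric.ball (1, 0) η) R, velocity ψ α R =ᶠ[𝓝 x]
      cartesianVelocity (axialSlope β R) (swirl ψ α R) (radialSlope ψ α R) := fun x hx => by
    filter_upwards [(isOpen_region Metric.isOpen_ball R).mem_nhds hx] with y hy
      using hp.velocity_eq hR hy
  refine ⟨⟨fun x hx => ?_, fun x hx => ?_, fun x hx => ?_, fun x hx => ?_⟩, fun x hx => ?_⟩
  · exact ((hp.contDiffAt_velocity h hR hH hx).of_le le_top).contDiffWithinAt
  · exact ((hp.contDiffAt_pressure hR hx.1).of_le le_top).contDiffWithinAt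
  all_goals obtain ⟨A, B, C, hE⟩ := hp.eulerRelations h hR hH hx
  · rw [← hE.convective_eq, convective, convective, (heq x hx.1).fderiv_eq, (heq x hx.1).eq_of_nhds]
  · rw [← hE.divergence_eq, divergence, divergence, (heq x hx.1).fderiv_eq]
  · rw [hp.velocity_eq hR hx.1, inner_gradient]
    exact ⟨hE.fderiv_pressure_velocity, hE.norm_sq⟩

end

/-! ### Axial symmetry. -/

section rotation

variable (θ : ℝ) (x : E3)

lemma rotZ_add (u v : E3) : rotZ θ (u + v) = rotZ θ u + rotZ θ v := by
  ext i
  fin_cases i <;> simp [rotZ] <;> ring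

lemma rotZ_smul (c : ℝ) (u : E3) : rotZ θ (c • u) = c • rotZ θ u := by
  ext i
  fin_cases i <;> simp [rotZ] <;> ring

lemma rotZ_sub (u v : E3) : rotZ θ (u - v) = rotZ θ u - rotZ θ v := by
  ext i
  fin_cases i <;> simp [rotZ] <;> ring

@[simp] lemma rotZ_apply_two : rotZ θ x 2 = x 2 := by simp [rotZ]

@[simp] lemma rho_rotZ : rho (rotZ θ x) = rho x := by
  unfold rho rotZ
  congr 1
  simp
  linear_combination (x 0 ^ 2 + x 1 ^ 2) * Real.sin_sq_add_cos_sq θ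

lemma eRho_rotZ : eRho (rotZ θ x) = rotZ θ (eRho x) := by
  ext i
  unfold eRho
  rw [rho_rotZ]
  fin_cases i <;> simp [rotZ] <;> ring

lemma ePhi_rotZ : ePhi (rotZ θ x) = rotZ θ (ePhi x) := by
  ext i
  unfold ePhi
  rw [rho_rotZ]
  fin_cases i <;> simp [rotZ] <;> ring

lemma rotZ_eZ : rotZ θ eZ = eZ := by
  ext i
  fin_cases i <;> simp [rotZ, eZ]

lemma rotZ_zero : rotZ θ 0 = 0 := by
  ext i
  fin_cases i <;> simp [rotZ]

end rotation

lemma isAxisymmetric_velocity (ψ : ℝ → ℝ) (α : ℝ × ℝ → ℝ) (R : ℝ) :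
    IsAxisymmetric (velocity ψ α R) := by
  intro θ x
  simp only [velocity, swirl, rho_rotZ, rotZ_apply_two, eRho_rotZ, ePhi_rotZ, rotZ_add, rotZ_sub,
    rotZ_smul, rotZ_eZ]

lemma isAxisymmetric_modulated (ψ : ℝ → ℝ) (α : ℝ × ℝ → ℝ) (U : Set (ℝ × ℝ)) (R : ℝ)
    (w : ℝ → ℝ) : IsAxisymmetric (modulated ψ α U R w) := by
  intro θ x
  have h1 : rotZ θ x ∈ region U R ↔ x ∈ region U R := by simp [region]
  have h2 : pressure α R (rotZ θ x) = pressure α R x := by simp [pressure]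
  by_cases hx : x ∈ region U R
  · rw [modulated, modulated, if_pos hx, if_pos (h1.2 hx), h2, isAxisymmetric_velocity, rotZ_smul]
  · rw [modulated, modulated, if_neg hx, if_neg (mt h1.1 hx), rotZ_zero]

/-! ### Multiplication by a first integral. -/

lemma sum_mul_fderiv_single (f : E3 → ℝ) (x v : E3) :
    ∑ i : Fin 3, fderiv ℝ f x (EuclideanSpace.single i 1) * v i = fderiv ℝ f x v := by
  rw [← inner_gradient, PiLp.inner_apply]
  exact Finset.sum_congr rfl fun i _ => by simp [gradient_apply_coord]

section modulate

variable {u : E3 → E3} {f : E3 → ℝ} {x : E3}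

/-- Multiplying a field by a first integral multiplies its convective term by the square. -/
lemma convective_smul (hu : DifferentiableAt ℝ u x) (hf : DifferentiableAt ℝ f x)
    (h0 : fderiv ℝ f x (u x) = 0) :
    convective (fun y => f y • u y) x = f x ^ 2 • convective u x := by
  rw [convective, fderiv_fun_smul hf hu]
  simp [h0, convective, smul_smul, sq]

lemma divergence_smul (hu : DifferentiableAt ℝ u x) (hf : DifferentiableAt ℝ f x)
    (h0 : fderiv ℝ f x (u x) = 0) :
    divergence (fun y => f y • u y) x = f x * divergence u x := by
  rw [divergence, fderiv_fun_smul hf hu]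
  simp only [_root_.add_apply, _root_.smul_apply,
    ContinuousLinearMap.smulRight_apply, PiLp.add_apply, PiLp.smul_apply, smul_eq_mul,
    Finset.sum_add_distrib, sum_mul_fderiv_single, h0, add_zero, divergence, Finset.mul_sum]

end modulate

lemma convective_of_eventuallyEq {u v : E3 → E3} {x : E3} (h : u =ᶠ[𝓝 x] v) :
    convective u x = convective v x := by
  rw [convective, convective, h.fderiv_eq, h.eq_of_nhds]

lemma divergence_of_eventuallyEq {u v : E3 → E3} {x : E3} (h : u =ᶠ[𝓝 x] v) :
    divergence u x = divergence v x := by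
  rw [divergence, divergence, h.fderiv_eq]

lemma gradient_comp {p : E3 → ℝ} {k : ℝ → ℝ} {k' : ℝ} {x : E3} (hp : DifferentiableAt ℝ p x)
    (hk : HasDerivAt k k' (p x)) : gradient (fun y => k (p y)) x = k' • gradient p x := by
  have h1 := (hk.comp_hasFDerivAt x hp.hasFDerivAt).fderiv
  ext i
  rw [gradient_apply_coord, show (fun y => k (p y)) = k ∘ p from rfl, h1, PiLp.smul_apply,
    gradient_apply_coord]
  rfl

lemma gradient_of_eventuallyEq {p q : E3 → ℝ} {x : E3} (h : p =ᶠ[𝓝 x] q) :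
    gradient p x = gradient q x := by
  rw [gradient, gradient, h.fderiv_eq]

/-! ### Level sets of the pressure near the circle. -/

/-- Compactness of the closed solid torus over a closed ball of the half plane. -/
lemma isCompact_preimage_meridian {R : ℝ} (hR : 0 < R) (q : ℝ × ℝ) (s : ℝ) :
    IsCompact (meridian R ⁻¹' Metric.closedBall q s) := by
  refine Metric.isCompact_of_isClosed_isBounded
    (Metric.isClosed_closedBall.preimage (continuous_meridian R)) ?_
  rw [isBounded_iff_forall_norm_le]
  refine ⟨Real.sqrt ((R * (|q.1| + s)) ^ 2 + (R * (|q.2| + s)) ^ 2), fun x hx => ?_⟩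
  rw [mem_preimage, Metric.mem_closedBall, Prod.dist_eq, max_le_iff, Real.dist_eq,
    Real.dist_eq] at hx
  have h1 : |rho x / R| ≤ |q.1| + s := by
    have := abs_sub_abs_le_abs_sub (rho x / R) q.1
    have h := hx.1
    simp only [meridian] at h
    linarith
  have h2 : |x 2 / R| ≤ |q.2| + s := by
    have := abs_sub_abs_le_abs_sub (x 2 / R) q.2
    have h := hx.2
    simp only [meridian] at h
    linarith
  rw [abs_div, abs_of_pos hR, div_le_iff₀ hR] at h1 h2
  rw [EuclideanSpace.norm_eq]
  apply Real.sqrt_le_sqrt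
  simp only [Fin.sum_univ_three, Real.norm_eq_abs, sq_abs]
  rw [← rho_sq, ← sq_abs (rho x), ← sq_abs (x 2)]
  rw [mul_comm R, mul_comm R]
  gcongr

section

variable {ψ : ℝ → ℝ} {r η R : ℝ} {α β : ℝ × ℝ → ℝ}

theorem IsProfile.isAlpha (hp : IsProfile ψ r α β η) : IsAlpha ψ r α (Metric.ball (1, 0) η) where
  isOpen := Metric.isOpen_ball
  mem := Metric.mem_ball_self hp.pos
  off_axis q hq := by
    rw [← ball_prod_same, mem_prod, Real.ball_eq_Ioo] at hq
    linarith [hq.1.1, hp.lt_one]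
  analytic := hp.analytic
  range := hp.range
  eq_x q hq := (hp.fst q hq).deriv
  eq_y q hq := by rw [(hp.snd q hq).deriv, hp.sq_eq q hq]
  nondegenerate := by
    have hη := hp.pos
    have hm : ((1 : ℝ), η / 2) ∈ Metric.ball ((1 : ℝ), (0 : ℝ)) η := by
      rw [← ball_prod_same, mem_prod, Real.ball_eq_Ioo, Real.ball_eq_Ioo]
      constructor <;> constructor <;> simp <;> linarith
    refine ⟨_, hm, ?_⟩
    rw [(hp.snd _ hm).deriv]
    exact hp.ne_zero _ hm (by simpa using hη.ne')
  value := hp.value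
  strict_min q hq hne := by
    rw [hp.value]
    refine lt_of_lt_of_le ?_ (hp.growth q hq)
    by_contra hcon
    push Not at hcon
    refine hne (Prod.ext ?_ ?_)
    · nlinarith [sq_nonneg (q.1 - 1), sq_nonneg q.2]
    · simp only
      nlinarith [sq_nonneg (q.1 - 1), sq_nonneg q.2]

lemma IsProfile.pressure_of_mem_circleR (hp : IsProfile ψ r α β η) (hR : 0 < R) {x : E3}
    (hx : x ∈ circleR R) : pressure α R x = 0 := by
  simp [pressure, pressureProfile, hx.1, hx.2, hR.ne', hp.value]

/-- Points of small pressure are close to the circle. -/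
lemma IsProfile.dist_sq_lt (hp : IsProfile ψ r α β η) (hR : 0 < R) {k ε : ℝ}
    (hε : ε < R ^ 4 / 8 * k ^ 2) {x : E3} (hx : x ∈ region (Metric.ball (1, 0) η) R)
    (hpx : pressure α R x ≤ 2 * ε) : (rho x / R - 1) ^ 2 + (x 2 / R) ^ 2 < k ^ 2 := by
  have h1 := hp.growth _ hx
  have h2 : R ^ 4 / 4 * α (rho x / R, x 2 / R) ≤ 2 * ε := hpx
  have h3 : 0 < R ^ 4 / 4 := by positivity
  have h4 : R ^ 4 / 4 * α (rho x / R, x 2 / R) < R ^ 4 / 4 * k ^ 2 := by linarith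
  exact lt_of_le_of_lt h1 (lt_of_mul_lt_mul_left h4 h3.le)

/-- The pressure takes every small positive value. -/
lemma IsProfile.exists_pressure_eq (hp : IsProfile ψ r α β η) (hR : 0 < R) {s : ℝ} (hs : 0 ≤ s)
    (hs' : s ≤ R ^ 4 / 4 * (η / 2) ^ 2) :
    ∃ x ∈ region (Metric.ball (1, 0) η) R, pressure α R x = s := by
  have hη := hp.pos
  have hm : ∀ t ∈ Icc 1 (1 + η / 2), (t, (0 : ℝ)) ∈ Metric.ball ((1 : ℝ), (0 : ℝ)) η := by
    intro t ht
    rw [← ball_prod_same, mem_prod, Real.ball_eq_Ioo, Real.ball_eq_Ioo]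
    constructor <;> constructor <;> simp <;> linarith [ht.1, ht.2]
  have hc : ContinuousOn (fun t => R ^ 4 / 4 * α (t, 0)) (Icc 1 (1 + η / 2)) := fun t ht =>
    (continuousAt_const.mul (hp.fst _ (hm t ht)).continuousAt).continuousWithinAt
  have hend := hp.growth _ (hm (1 + η / 2) ⟨by linarith, le_rfl⟩)
  have hmem : s ∈ Icc (R ^ 4 / 4 * α (1, 0)) (R ^ 4 / 4 * α (1 + η / 2, 0)) := by
    rw [hp.value, mul_zero]
    refine ⟨hs, hs'.trans ?_⟩
    refine mul_le_mul_of_nonneg_left ?_ (by positivity)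
    simpa using hend
  -- Along the ray `y = 0`, `x ≥ 1` the pressure runs from `0` to at least `R⁴/4 · (η/2)²`.
  obtain ⟨t, ht, hts⟩ := intermediate_value_Icc (by linarith) hc hmem
  have hρ : rho !₂[R * t, 0, 0] = R * t := by
    have : 0 ≤ R * t := mul_nonneg hR.le (by linarith [ht.1])
    simp [rho, Real.sqrt_sq this]
  have h1 : R * t / R = t := by field_simp
  refine ⟨!₂[R * t, 0, 0], ?_, ?_⟩
  · simp only [region, mem_ofPred_eq, hρ, h1]
    simpa using hm t ht
  · rw [← hts, pressure, pressureProfile, hρ, h1]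
    simp

end

/-! ### The modulated flow and its pressure. -/

/-- A smooth function on the line has a smooth primitive vanishing at a given point. -/
lemma exists_contDiff_primitive {f : ℝ → ℝ} (hf : ContDiff ℝ ∞ f) (c : ℝ) :
    ∃ W : ℝ → ℝ, ContDiff ℝ ∞ W ∧ (∀ s, HasDerivAt W (f s) s) ∧ ∀ s, W s = ∫ t in c..s, f t := by
  have hd : ∀ s, HasDerivAt (fun s => ∫ t in c..s, f t) (f s) s := fun s =>
    (hf.continuous.integral_hasStrictDerivAt c s).hasDerivAt
  refine ⟨_, contDiff_infty_iff_deriv.2 ⟨fun s => (hd s).differentiableAt, ?_⟩, hd, fun _ => rfl⟩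
  rwa [show deriv (fun s => ∫ t in c..s, f t) = f from funext fun s => (hd s).deriv]

open Classical in
/-- The function `W(p)` of the pressure in the region over `U`, and zero elsewhere. -/
noncomputable def modulatedPressure (α : ℝ × ℝ → ℝ) (U : Set (ℝ × ℝ)) (R : ℝ) (W : ℝ → ℝ)
    (x : E3) : ℝ :=
  if x ∈ region U R then W (pressure α R x) else 0

section

variable {ψ : ℝ → ℝ} {r η R δ ε : ℝ} {α β : ℝ × ℝ → ℝ}

/-- Sublevel sets of the pressure in the region are compact, as long as they are small. -/
lemma IsProfile.isCompact_sublevel (hp : IsProfile ψ r α β η) (hR : 0 < R)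
    (hε : ε < R ^ 4 / 8 * (η / 2) ^ 2) {s : Set ℝ} (hs : IsClosed s) (hsε : s ⊆ Iic (2 * ε)) :
    IsCompact {x | x ∈ region (Metric.ball (1, 0) η) R ∧ pressure α R x ∈ s} := by
  have hη := hp.pos
  have hsub : meridian R ⁻¹' Metric.closedBall (1, 0) (η / 2) ⊆ region (Metric.ball (1, 0) η) R :=
    fun x hx => Metric.closedBall_subset_ball (by linarith) hx
  have heq : {x | x ∈ region (Metric.ball (1, 0) η) R ∧ pressure α R x ∈ s}
      = meridian R ⁻¹' Metric.closedBall (1, 0) (η / 2) ∩ pressure α R ⁻¹' s := by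
    ext x
    refine ⟨fun hx => ⟨?_, hx.2⟩, fun hx => ⟨hsub hx.1, hx.2⟩⟩
    -- Pressure at most `2ε` means `α ≤ 8ε/R⁴ < (η/2)²`, so quadratic growth keeps the set away from
    -- the boundary of the region.
    have h1 := hp.dist_sq_lt hR hε hx.1 (hsε hx.2)
    have h2 : (0 : ℝ) ≤ η / 2 := by linarith
    rw [mem_preimage, Metric.mem_closedBall, Prod.dist_eq, max_le_iff, Real.dist_eq, Real.dist_eq]
    simp only [meridian, sub_zero]
    exact ⟨abs_le_of_sq_le_sq (by nlinarith [sq_nonneg (x 2 / R)]) h2,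
      abs_le_of_sq_le_sq (by nlinarith [sq_nonneg (rho x / R - 1)]) h2⟩
  rw [heq]
  have hK := isCompact_preimage_meridian hR (1, 0) (η / 2)
  refine hK.of_isClosed_subset (ContinuousOn.preimage_isClosed_of_isClosed (fun x hx => ?_)
    hK.isClosed hs) inter_subset_left
  exact (hp.contDiffAt_pressure hR (hsub hx)).continuousAt.continuousWithinAt

/-- As `W` vanishes from `2ε` on, the function is zero off the compact set of points of the region
with pressure at most `2ε`. Extension by zero is therefore smooth across the boundary of the region.
-/
lemma smooth_modulatedPressure (hp : IsProfile ψ r α β η) (hR : 0 < R)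
    (hε : ε < R ^ 4 / 8 * (η / 2) ^ 2) {W : ℝ → ℝ} (hW : ContDiff ℝ ∞ W)
    (hW0 : ∀ s, 2 * ε ≤ s → W s = 0) (x : E3) :
    ContDiffAt ℝ ∞ (modulatedPressure α (Metric.ball (1, 0) η) R W) x ∧
      (x ∉ region (Metric.ball (1, 0) η) R →
        modulatedPressure α (Metric.ball (1, 0) η) R W =ᶠ[𝓝 x] fun _ => 0) := by
  by_cases hx : x ∈ region (Metric.ball (1, 0) η) R
  · refine ⟨?_, fun h => absurd hx h⟩
    have heq : modulatedPressure α (Metric.ball (1, 0) η) R W =ᶠ[𝓝 x]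
        fun y => W (pressure α R y) := by
      filter_upwards [(isOpen_region Metric.isOpen_ball R).mem_nhds hx] with y hy
      simp [modulatedPressure, hy]
    exact (ContDiffAt.comp x hW.contDiffAt
      ((hp.contDiffAt_pressure hR hx).of_le le_top)).congr_of_eventuallyEq heq
  · have hK := hp.isCompact_sublevel hR hε isClosed_Iic (le_refl (Iic (2 * ε)))
    have heq : modulatedPressure α (Metric.ball (1, 0) η) R W =ᶠ[𝓝 x] fun _ => 0 := by
      filter_upwards [hK.isClosed.isOpen_compl.mem_nhds fun h => hx h.1] with y hy
      by_cases hyr : y ∈ region (Metric.ball (1, 0) η) R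
      · have : 2 * ε ≤ pressure α R y := by
          by_contra hcon
          exact hy ⟨hyr, (not_le.1 hcon).le⟩
        simp [modulatedPressure, hW0 _ this]
      · simp [modulatedPressure, hyr]
    exact ⟨contDiffAt_const.congr_of_eventuallyEq heq, fun _ => heq⟩

/-- The modulations of the intermediate flow. -/
theorem IsProfile.modulated_spec (h : IsPsi ψ r) (hp : IsProfile ψ r α β η) (hR : 0 < R)
    (hH : ∀ a ∈ Ioo (-r) r, 0 < 1 / deriv ψ a + 2 * ψ a) (hε : 0 < ε)
    (hεη : ε < R ^ 4 / 8 * (η / 2) ^ 2) (hεδ : ε < R ^ 4 / 8 * (δ / R) ^ 2) {w : ℝ → ℝ}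
    (hw : ContDiff ℝ ∞ w) (hsupp : tsupport w ⊆ Icc ε (2 * ε)) :
    HasCompactSupport (modulated ψ α (Metric.ball (1, 0) η) R w) ∧
    tsupport (modulated ψ α (Metric.ball (1, 0) η) R w)
      ⊆ solidTorus R δ ∩ region (Metric.ball (1, 0) η) R ∧
    IsAxisymmetric (modulated ψ α (Metric.ball (1, 0) η) R w) ∧
    (w ≠ 0 → modulated ψ α (Metric.ball (1, 0) η) R w ≠ 0) ∧
    ∃ p' : E3 → ℝ,
      IsSteadyEulerOn (modulated ψ α (Metric.ball (1, 0) η) R w) p' univ ∧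
      ∀ x ∈ region (Metric.ball (1, 0) η) R,
        gradient p' x = (w (pressure α R x)) ^ 2 • gradient (pressure α R) x := by
  have hw0 : ∀ s, s ∉ Icc ε (2 * ε) → w s = 0 := fun s hs =>
    image_eq_zero_of_notMem_tsupport fun h => hs (hsupp h)
  set D := region (Metric.ball ((1 : ℝ), (0 : ℝ)) η) R with hD
  have hDo : IsOpen D := isOpen_region Metric.isOpen_ball R
  set S : Set E3 := {x | x ∈ D ∧ pressure α R x ∈ Icc ε (2 * ε)} with hS
  have hScomp : IsCompact S := hp.isCompact_sublevel hR hεη isClosed_Icc fun s hs => hs.2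
  have hsub : tsupport (modulated ψ α (Metric.ball (1, 0) η) R w) ⊆ S := by
    refine closure_minimal (fun x hx => ?_) hScomp.isClosed
    rw [Function.mem_support, modulated] at hx
    split_ifs at hx with hxD
    · refine ⟨hxD, ?_⟩
      by_contra hcon
      exact hx (by rw [hw0 _ hcon, zero_smul])
    · exact absurd rfl hx
  have hScirc : ∀ x ∈ S, x ∈ D \ circleR R := fun x hx => ⟨hx.1, fun hc => by
    have := hx.2.1
    rw [hp.pressure_of_mem_circleR hR hc] at this
    linarith⟩
  have hSδ : S ⊆ solidTorus R δ := fun x hx => by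
    have h1 := hp.dist_sq_lt hR hεδ hx.1 hx.2.2
    have h2 : (rho x / R - 1) ^ 2 + (x 2 / R) ^ 2 = ((rho x - R) ^ 2 + x 2 ^ 2) / R ^ 2 := by
      field_simp
    rw [h2, div_pow, div_lt_div_iff_of_pos_right (by positivity)] at h1
    exact h1
  have hne : w ≠ 0 → modulated ψ α (Metric.ball (1, 0) η) R w ≠ 0 := by
    intro hwne hzero
    obtain ⟨s, hs⟩ := Function.ne_iff.1 hwne
    have hsI : s ∈ Icc ε (2 * ε) := by
      by_contra hcon
      exact hs (hw0 s hcon)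
    -- Where the pressure is a value `s > 0` with `w s ≠ 0`, `|u|² = 3s` forces the modulated field
    -- to be nonzero.
    obtain ⟨x, hxD, hxs⟩ := hp.exists_pressure_eq hR (s := s) (hε.le.trans hsI.1)
      (hsI.2.trans (by linarith))
    have hx : x ∈ D \ circleR R := hScirc x ⟨hxD, by rw [hxs]; exact hsI⟩
    have h1 := ((hp.isSteadyEulerOn h hR hH).2 x hx).2
    have h2 := congrFun hzero x
    rw [modulated, if_pos hxD, hxs, Pi.zero_apply, smul_eq_zero] at h2
    rw [h2.resolve_left hs, hxs, norm_zero] at h1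
    linarith [hsI.1]
  refine ⟨hScomp.of_isClosed_subset (isClosed_tsupport _) hsub,
    hsub.trans fun x hx => ⟨hSδ hx, hx.1⟩, isAxisymmetric_modulated _ _ _ _ _, hne, ?_⟩
  -- The new pressure is `W(p)` with `W' = w²`. The base point `2ε` makes it vanish towards the
  -- boundary of the region; near the circle it is a constant, possibly nonzero.
  obtain ⟨W, hWc, hWd, hWi⟩ := exists_contDiff_primitive (hw.pow 2) (2 * ε)
  have hW0 : ∀ s, 2 * ε ≤ s → W s = 0 := fun s hs => by
    rw [hWi, intervalIntegral.integral_congr_ae (g := fun _ => 0), intervalIntegral.integral_zero]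
    refine Eventually.of_forall fun t ht => ?_
    rw [uIoc_of_le hs] at ht
    rw [hw0 t fun h => absurd h.2 (not_le.2 ht.1)]
    simp
  have hsm := smooth_modulatedPressure hp hR hεη hWc hW0
  have hgrad : ∀ x ∈ D, gradient (modulatedPressure α (Metric.ball (1, 0) η) R W) x
      = (w (pressure α R x)) ^ 2 • gradient (pressure α R) x := fun x hx => by
    rw [← gradient_comp ((hp.contDiffAt_pressure hR hx).differentiableAt (by simp)) (hWd _)]
    apply gradient_of_eventuallyEq
    filter_upwards [hDo.mem_nhds hx] with y hy
    exact if_pos hy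
  have hinside : ∀ x ∈ D \ circleR R, modulated ψ α (Metric.ball (1, 0) η) R w =ᶠ[𝓝 x]
      fun y => w (pressure α R y) • velocity ψ α R y := fun x hx => by
    filter_upwards [hDo.mem_nhds hx.1] with y hy
    exact if_pos hy
  have houtside : ∀ x ∉ D \ circleR R,
      modulated ψ α (Metric.ball (1, 0) η) R w =ᶠ[𝓝 x] fun _ => 0 := fun x hx => by
    filter_upwards [hScomp.isClosed.isOpen_compl.mem_nhds fun h => hx (hScirc x h)] with y hy
    exact image_eq_zero_of_notMem_tsupport fun h => hy (hsub h)
  have hwp : ∀ x ∈ D, ContDiffAt ℝ ∞ (fun y => w (pressure α R y)) x := fun x hx =>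
    ContDiffAt.comp x hw.contDiffAt ((hp.contDiffAt_pressure hR hx).of_le le_top)
  have hu : ∀ x ∈ D \ circleR R, ContDiffAt ℝ ∞ (velocity ψ α R) x := fun x hx =>
    (hp.contDiffAt_velocity h hR hH hx).of_le le_top
  have hintegral : ∀ x ∈ D \ circleR R,
      fderiv ℝ (fun y => w (pressure α R y)) x (velocity ψ α R x) = 0 := fun x hx => by
    have h1 := ((hp.isSteadyEulerOn h hR hH).2 x hx).1
    rw [← inner_gradient, gradient_comp ((hp.contDiffAt_pressure hR hx.1).differentiableAt
      (by simp)) (hw.differentiable (by simp) _).hasDerivAt, inner_smul_right, h1, mul_zero]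
  refine ⟨_, ⟨fun x _ => ?_, fun x _ => (hsm x).1.contDiffWithinAt, fun x _ => ?_, fun x _ => ?_⟩,
    hgrad⟩
  all_goals by_cases hx : x ∈ D \ circleR R
  · exact (((hwp x hx.1).smul (hu x hx)).congr_of_eventuallyEq (hinside x hx)).contDiffWithinAt
  · exact (contDiffAt_const.congr_of_eventuallyEq (houtside x hx)).contDiffWithinAt
  · rw [convective_of_eventuallyEq (hinside x hx), convective_smul ((hu x hx).differentiableAt
      (by simp)) ((hwp x hx.1).differentiableAt (by simp)) (hintegral x hx), hgrad x hx.1,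
      (hp.isSteadyEulerOn h hR hH).1.momentum x hx, smul_neg]
  -- The field vanishes near such a point, which is either on the circle, where `w(0)² = 0`, or
  -- outside the region, where the pressure is locally zero.
  · have hg : gradient (modulatedPressure α (Metric.ball (1, 0) η) R W) x = 0 := by
      by_cases hxD : x ∈ D
      · have hc : x ∈ circleR R := by
          by_contra hcon
          exact hx ⟨hxD, hcon⟩
        rw [hgrad x hxD, hp.pressure_of_mem_circleR hR hc, hw0 0 fun h => absurd h.1 (not_le.2 hε)]
        simp
      · rw [gradient_of_eventuallyEq ((hsm x).2 hxD)]
        simp [gradient]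
    rw [convective_of_eventuallyEq (houtside x hx), hg]
    simp [convective]
  · rw [divergence_of_eventuallyEq (hinside x hx), divergence_smul ((hu x hx).differentiableAt
      (by simp)) ((hwp x hx.1).differentiableAt (by simp)) (hintegral x hx),
      (hp.isSteadyEulerOn h hR hH).1.incompressible x hx, mul_zero]
  · rw [divergence_of_eventuallyEq (houtside x hx)]
    simp [divergence]

end

/-- A nonzero smooth function supported in `[ε, 2 ε]`. -/
lemma exists_modulation {ε : ℝ} (hε : 0 < ε) :
    ∃ w : ℝ → ℝ, ContDiff ℝ ∞ w ∧ tsupport w ⊆ Icc ε (2 * ε) ∧ w ≠ 0 := by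
  -- Centre `3ε/2` and outer radius `ε/2` make the support exactly `[ε, 2ε]`.
  let f : ContDiffBump (3 / 2 * ε) := ⟨ε / 4, ε / 2, by positivity, by linarith⟩
  refine ⟨f, f.contDiff, ?_, fun h0 => ?_⟩
  · rw [f.tsupport_eq, Real.closedBall_eq_Icc]
    apply Icc_subset_Icc <;> simp only [f] <;> linarith
  · have h1 := f.one_of_mem_closedBall (Metric.mem_closedBall_self f.rIn_pos.le)
    rw [h0] at h1
    simp at h1

end SteadyEuler

/-! ### Assembly. -/

open SteadyEuler
theorem mainTheorem1 :
    -- the headline: nonzero compactly supported smooth flows close to any circle `ρ = R`, `z = 0`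
    (∀ R : ℝ, 0 < R → ∀ δ : ℝ, 0 < δ → ∃ (u : E3 → E3) (p : E3 → ℝ),
      u ≠ 0 ∧ IsSteadyEulerOn u p Set.univ ∧ HasCompactSupport u ∧
      tsupport u ⊆ solidTorus R δ ∧ IsAxisymmetric u) ∧
    -- the construction
    ∃ (ψ : ℝ → ℝ) (r : ℝ) (α : ℝ × ℝ → ℝ) (U : Set (ℝ × ℝ)),
      IsPsi ψ r ∧ IsAlpha ψ r α U ∧
      ∀ R : ℝ, 0 < R →
        -- the intermediate flow, defined around the circle
        (IsSteadyEulerOn (velocity ψ α R) (pressure α R) (region U R \ circleR R) ∧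
          IsAxisymmetric (velocity ψ α R) ∧
          ∀ x ∈ region U R \ circleR R,
            inner ℝ (velocity ψ α R x) (gradient (pressure α R) x) = 0 ∧
            ‖velocity ψ α R x‖ ^ 2 = 3 * pressure α R x) ∧
        -- its modulations
        ∀ δ : ℝ, 0 < δ → ∃ ε₀ : ℝ, 0 < ε₀ ∧ ∀ ε : ℝ, 0 < ε → ε < ε₀ →
          ∀ w : ℝ → ℝ, ContDiff ℝ ∞ w → tsupport w ⊆ Set.Icc ε (2 * ε) →
            HasCompactSupport (modulated ψ α U R w) ∧
            tsupport (modulated ψ α U R w) ⊆ solidTorus R δ ∩ region U R ∧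
            IsAxisymmetric (modulated ψ α U R w) ∧
            (w ≠ 0 → modulated ψ α U R w ≠ 0) ∧
            ∃ p' : E3 → ℝ, IsSteadyEulerOn (modulated ψ α U R w) p' Set.univ ∧
              ∀ x ∈ region U R,
                gradient p' x = (w (pressure α R x)) ^ 2 • gradient (pressure α R) x := by
  obtain ⟨ψ, r, h, hH⟩ := exists_isPsi
  obtain ⟨α, β, η, hp⟩ := h.exists_isProfile
  have hη := hp.pos
  -- The first bound keeps the support inside the region, the second inside the solid torus.
  have hmod : ∀ R : ℝ, 0 < R → ∀ δ : ℝ, 0 < δ → ∃ ε₀ : ℝ, 0 < ε₀ ∧ ∀ ε : ℝ, 0 < ε → ε < ε₀ →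
      ε < R ^ 4 / 8 * (η / 2) ^ 2 ∧ ε < R ^ 4 / 8 * (δ / R) ^ 2 := fun R hR δ hδ =>
    ⟨min (R ^ 4 / 8 * (η / 2) ^ 2) (R ^ 4 / 8 * (δ / R) ^ 2), by positivity,
      fun ε _ hε => lt_min_iff.1 hε⟩
  refine ⟨fun R hR δ hδ => ?_, ψ, r, α, Metric.ball (1, 0) η, h, hp.isAlpha, fun R hR => ⟨?_, ?_⟩⟩
  · obtain ⟨ε₀, hε₀, hε⟩ := hmod R hR δ hδ
    obtain ⟨h1, h2⟩ := hε (ε₀ / 2) (by positivity) (by linarith)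
    obtain ⟨w, hw, hsupp, hw0⟩ := exists_modulation (half_pos hε₀)
    obtain ⟨hc, ht, ha, hne, p, hE, -⟩ :=
      hp.modulated_spec h hR hH (half_pos hε₀) h1 h2 hw hsupp
    exact ⟨_, p, hne hw0, hE, hc, ht.trans inter_subset_left, ha⟩
  · exact ⟨(hp.isSteadyEulerOn h hR hH).1, isAxisymmetric_velocity ψ α R,
      (hp.isSteadyEulerOn h hR hH).2⟩
  · intro δ hδ
    obtain ⟨ε₀, hε₀, hε⟩ := hmod R hR δ hδ
    refine ⟨ε₀, hε₀, fun ε hε0 hεε w hw hsupp => ?_⟩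
    obtain ⟨h1, h2⟩ := hε ε hε0 hεε
    exact hp.modulated_spec h hR hH hε0 h1 h2 hw hsupp
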